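/- **Conventions.** Let $V$ be a complex $*$-vector space, $V_h$ its hermitian elements, $\|\cdot\|$ a norm on $V$ with $\|v^*\|=\|v\|$, and $0\neq e\in V_h$. For $\varepsilon>0$ let $S_\varepsilon$ be the set of linear functionals $\varphi$ on $V$ that are hermitian ($\varphi(v^*)=\overline{\varphi(v)}$), satisfy $\varphi(e)=1$, and have dual norm $\|\varphi\|\le\varepsilon$. The triple $(V,\|\cdot\|,e)$ is a *unital $*$-normed space* with unit $e$ if $S_1\neq\varnothing$; it is an *abstract function system* if moreover $\{v:\|v\|\le 1\}=\{v:|\varphi(v)|\le1\ \forall\varphi\in S_1\}$. Put $\mathfrak c_\varepsilon=\{v\in V_h:\varphi(v)\ge0\ \forall\varphi\in S_\varepsilon\}$ and $\|v\|_\varepsilon=\sup_{\varphi\in S_\varepsilon}|\varphi(v)|$. A cone $\mathfrak c\subseteq V_h$ is *separated* if $\mathfrak c\cap(-\mathfrak c)=\{0\}$ and *unital* if $\mathfrak c-e$ absorbs $V_h$; its *state space* $S(\mathfrak c)$ is the set of linear functionals $\varphi$ with $\varphi(e)=1$ and $\varphi\ge0$ on $\mathfrak c$. We say that $V$ *is a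 function system equipped with* $\mathfrak c_\varepsilon$ if: $\mathfrak c_\varepsilon$ is a separated, closed, unital cone with $S(\mathfrak c_\varepsilon)=S_\varepsilon$; $\|\cdot\|_\varepsilon$ is a norm equivalent to $\|\cdot\|$, and $(V,\|\cdot\|_\varepsilon,e)$ is an abstract function system with state space $S_\varepsilon$; and $S_\varepsilon$ is weak-$*$ compact Hausdorff and $v\mapsto(\varphi\mapsto\varphi(v))$ is a unital $*$-linear injection $V\to C(S_\varepsilon)$ that is an order isomorphism of $(V,\mathfrak c_\varepsilon)$ onto its range and whose sup norm is equivalent to $\|\cdot\|$. Let $n>1$, let $\mathbb M_n$ be the complex $n\times n$ matrices with trace $\tau$ and identity $e$, and for $1\le p\le\infty$ let $\mathfrak S_p$ be $\mathbb M_n$ with the Schatten norm $\|x\|_p=\tau(|x|^p)^{1/p}$ ($\|x\|_\infty$ is the operator norm). Let $\mathfrak S_p^+$ be the cone $\mathfrak c_1$ of $(\mathfrak S_p,e)$, let $M_n^+$ be the cone of positive semidefinite matrices, let $M_{n,\varepsilon}^+$ be the set of hermitian $x$ with $x\ge\|x\|_\infty\frac{\varepsilon-1}{\varepsilon+1}e$,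 and let $S_\tau=\{y\ge0:\tau(y)=1\}$ be the set of density matrices. A matrix $y$ is identified with the functional $x\mapsto\tau(xy)$. Finally let $(x,y)=\tau(xy^*)$, $e_2=n^{-1/2}e$, and $HS_n^+=\{x=x^*:\|x\|_2\le(\tfrac{n}{n-1})^{1/2}(x,e_2)\}$. **Theorem.** Let $n>1$. 1. For every $1\le p\le\infty$, $(\mathfrak S_p,e)$ is a unital $*$-normed space, and it is a function system equipped with the cone $\mathfrak S_p^+$ (the case $\varepsilon=1$); moreover $1>1/\|e\|_p$ if $p<\infty$. 2. For every real $\varepsilon\ge n$, $M_{n,\varepsilon}^+$ is a separated, closed, unital cone and $M_{n,\varepsilon}^+\subseteq\mathfrak S_1^+$. If $1\le p_1\le p_2\le\infty$, then $\mathfrak S_{p_1}^+\subseteq\mathfrak S_{p_2}^+$, and $\mathfrak S_\infty^+=M_n^+$. In particular $M_{n,\varepsilon}^+\subseteq\mathfrak S_1^+\subseteq\mathfrak S_p^+\subseteq\mathfrak S_\infty^+=M_n^+$ for all $1\le p\le\infty$. 3. $S(M_n^+)=S_\tau$, and for all conjugate couples $(p,q)$ with $1\le p,q\le\infty$ $$S(\mathfrak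 S_p^+)=\{(1+r)z-rw:\ r\in\mathbb R,\ z,w\in S_\tau,\ zw=0,\ \|(1+r)z+rw\|_q\le1\}.$$ Equivalently, $S(\mathfrak S_p^+)$ is the set of all $(1+r)z-rw$ with $r\ge0$, $z,w\in S_\tau$, $\|(1+r)z+rw\|_q\le1$, and $zw=0$ in case $r>0$. 4. $\mathfrak S_2^+=HS_n^+$. -/

import Mathlib

open scoped ComplexOrder MatrixOrder ENNReal

noncomputable section

namespace ProjPos

section General

variable {V : Type*} [AddCommGroup V] [Module ℂ V] [StarAddMonoid V] [StarModule ℂ V]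

/-- `N` is a norm on the complex `*`-vector space `V` for which the involution is isometric. -/
structure IsStarNorm (N : V → ℝ) : Prop where
  nonneg : ∀ v, 0 ≤ N v
  eq_zero_iff : ∀ v, N v = 0 ↔ v = 0
  smul : ∀ (a : ℂ) (v : V), N (a • v) = ‖a‖ * N v
  add_le : ∀ v w, N (v + w) ≤ N v + N w
  star : ∀ v, N (star v) = N v

/-- `S_ε`: the hermitian functionals `φ` on `(V, N)` with `φ e = 1` and dual norm `≤ ε`. -/
def epsStates (N : V → ℝ) (e : V) (ε : ℝ) : Set (V →ₗ[ℂ] ℂ) :=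
  {φ | (∀ v, φ (star v) = star (φ v)) ∧ φ e = 1 ∧ ∀ v, ‖φ v‖ ≤ ε * N v}

/-- `(V, N, e)` is a unital `*`-normed space: `N` is a `*`-norm, `e` is a nonzero hermitian
element, and there is a unital hermitian functional in the unit ball of the dual. -/
structure IsUnitalStarNormed (N : V → ℝ) (e : V) : Prop where
  isStarNorm : IsStarNorm N
  unit_hermitian : IsSelfAdjoint e
  unit_ne_zero : e ≠ 0
  states_nonempty : (epsStates N e 1).Nonempty

/-- The projective cone: the hermitian elements on which all of `S_ε` is nonnegative. -/
def projCone (N : V → ℝ) (e : V) (ε : ℝ) : Set V :=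
  {v | IsSelfAdjoint v ∧ ∀ φ ∈ epsStates N e ε, 0 ≤ φ v}

/-- The state space `S(c)` of a cone `c`: the unital linear functionals that are
nonnegative on `c`. -/
def coneStates (e : V) (c : Set V) : Set (V →ₗ[ℂ] ℂ) :=
  {φ | φ e = 1 ∧ ∀ v ∈ c, 0 ≤ φ v}

/-- The `ε`-norm `‖v‖_ε = sup {|φ v| : φ ∈ S_ε}`. -/
def epsNorm (N : V → ℝ) (e : V) (ε : ℝ) (v : V) : ℝ :=
  ⨆ φ : epsStates N e ε, ‖φ.1 v‖

/-- Equivalence of norms. -/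
def NormsEquivalent (N N' : V → ℝ) : Prop :=
  ∃ a b : ℝ, 0 < a ∧ 0 < b ∧ ∀ v, a * N v ≤ N' v ∧ N' v ≤ b * N v

/-- `c` is a separated, `N`-closed, unital (convex) cone of hermitian elements of `V`. Unital
means that `c - e` absorbs the hermitian elements: each hermitian `v` lies in `r (c - e)`,
that is, `v + r e ∈ c`, for all large `r`. -/
structure IsUnitalCone (N : V → ℝ) (e : V) (c : Set V) : Prop where
  hermitian : ∀ v ∈ c, IsSelfAdjoint v
  zero_mem : (0 : V) ∈ c
  add_mem : ∀ v ∈ c, ∀ w ∈ c, v + w ∈ c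
  smul_mem : ∀ r : ℝ, 0 ≤ r → ∀ v ∈ c, (r : ℂ) • v ∈ c
  separated : ∀ v, v ∈ c → -v ∈ c → v = 0
  closed : ∀ v, (∀ δ > 0, ∃ w ∈ c, N (v - w) < δ) → v ∈ c
  absorbing : ∀ v, IsSelfAdjoint v →
    ∃ r₀ : ℝ, 0 < r₀ ∧ ∀ r : ℝ, r₀ ≤ r → v + (r : ℂ) • e ∈ c

/-- An abstract function system: a unital `*`-normed space whose closed unit ball is the
absolute polar of its state space `S_1`. -/
structure IsAbstractFunctionSystem (N : V → ℝ) (e : V) : Prop where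
  isUnitalStarNormed : IsUnitalStarNormed N e
  ball_eq_polar : ∀ v, N v ≤ 1 ↔ ∀ φ ∈ epsStates N e 1, ‖φ v‖ ≤ 1

/-- A set of functionals on `V`, as a topological space with the weak-star topology
(pointwise convergence on `V`). -/
def WeakStar (S : Set (V →ₗ[ℂ] ℂ)) : Type _ := S

instance (S : Set (V →ₗ[ℂ] ℂ)) : TopologicalSpace (WeakStar S) :=
  TopologicalSpace.induced (fun (φ : S) (v : V) => φ.1 v) inferInstance

/-- `(V, N, e)` ordered by the cone `c` is a concrete function system on the set `S` of
functionals: `S` is compact Hausdorff in the weak-star topology, and evaluation is a unital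
`*`-linear injection of `V` into `C(S)` which is an order isomorphism and a
homeomorphism onto its range. -/
structure IsConcreteFunctionSystemOn (N : V → ℝ) (e : V) (c : Set V)
    (S : Set (V →ₗ[ℂ] ℂ)) : Prop where
  compact : CompactSpace (WeakStar S)
  hausdorff : T2Space (WeakStar S)
  representation : ∃ Φ : V →ₗ[ℂ] C(WeakStar S, ℂ),
    (∀ (v : V) (φ : S), Φ v φ = φ.1 v) ∧
    Function.Injective Φ ∧
    Φ e = 1 ∧
    (∀ v, Φ (star v) = star (Φ v)) ∧
    (∀ v, v ∈ c ↔ 0 ≤ Φ v) ∧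
    NormsEquivalent N (fun v => ⨆ φ : WeakStar S, ‖Φ v φ‖)

/-- `(V, N, e)` becomes a function system when it is equipped with the projective cone
defined by `ε`. -/
structure IsProjectiveFunctionSystem (N : V → ℝ) (e : V) (ε : ℝ) : Prop where
  isUnitalCone : IsUnitalCone N e (projCone N e ε)
  coneStates_eq : coneStates e (projCone N e ε) = epsStates N e ε
  abstract_system : IsAbstractFunctionSystem (epsNorm N e ε) e
  abstract_states : epsStates (epsNorm N e ε) e 1 = epsStates N e ε
  concrete : IsConcreteFunctionSystemOn N e (projCone N e ε) (epsStates N e ε)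
  norm_equiv : NormsEquivalent N (epsNorm N e ε)

end General

variable {n : ℕ}

/-- The Schatten norm: `‖x‖_p = τ(|x|^p)^(1/p)` for finite `p`, and the operator norm of `x` on
the Hilbert space `ℓ²(n)` for `p = ∞`. -/
def schattenNorm (p : ℝ≥0∞) (x : Matrix (Fin n) (Fin n) ℂ) : ℝ :=
  if p = ∞ then ‖Matrix.toEuclideanCLM (n := Fin n) (𝕜 := ℂ) x‖
  else (CFC.abs x ^ p.toReal).trace.re ^ (1 / p.toReal)

/-- The cone `𝔖_p^+` in `M_n`: the projective cone of `(𝔖_p, I)` for `ε = 1`. -/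
def schattenCone (n : ℕ) (p : ℝ≥0∞) : Set (Matrix (Fin n) (Fin n) ℂ) :=
  projCone (schattenNorm p) 1 1

/-- The cone `M_n^+` of positive semidefinite matrices. -/
def posCone (n : ℕ) : Set (Matrix (Fin n) (Fin n) ℂ) := {x | x.PosSemidef}

/-- The deformed cone `M_{n,ε}^+`: hermitian `x` with `x ≥ ‖x‖ (ε - 1)/(ε + 1) I`, where `‖x‖`
is the operator norm. -/
def deformedCone (n : ℕ) (ε : ℝ) : Set (Matrix (Fin n) (Fin n) ℂ) :=
  {x | x.IsHermitian ∧
    (x - ((schattenNorm ∞ x * ((ε - 1) / (ε + 1)) : ℝ) : ℂ) • 1).PosSemidef}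

/-- The set `S_τ` of density matrices. -/
def densityMatrices (n : ℕ) : Set (Matrix (Fin n) (Fin n) ℂ) :=
  {y | y.PosSemidef ∧ y.trace = 1}

/-- The functional `x ↦ τ(xy)` on `M_n` that is identified with the matrix `y`. -/
def traceFunctional (y : Matrix (Fin n) (Fin n) ℂ) : Matrix (Fin n) (Fin n) ℂ →ₗ[ℂ] ℂ where
  toFun x := (x * y).trace
  map_add' x x' := by rw [add_mul, Matrix.trace_add]
  map_smul' a x := by simp

/-- The matrices `(1 + r) z - r w` with `r` real, `z`, `w` orthogonal density matrices and
`‖(1 + r) z + r w‖_q ≤ 1`. -/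
def orthogonalDifferences (n : ℕ) (q : ℝ≥0∞) : Set (Matrix (Fin n) (Fin n) ℂ) :=
  {y | ∃ (r : ℝ) (z w : Matrix (Fin n) (Fin n) ℂ),
    z ∈ densityMatrices n ∧ w ∈ densityMatrices n ∧ z * w = 0 ∧
    schattenNorm q (((1 + r : ℝ) : ℂ) • z + (r : ℂ) • w) ≤ 1 ∧
    y = ((1 + r : ℝ) : ℂ) • z - (r : ℂ) • w}

/-- The same with `r ≥ 0`, where the density matrix `w`, which does not contribute when
`r = 0`, is required to be orthogonal to `z` only when `r > 0`. -/
def orthogonalDifferencesNonneg (n : ℕ) (q : ℝ≥0∞) : Set (Matrix (Fin n) (Fin n) ℂ) :=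
  {y | ∃ (r : ℝ) (z w : Matrix (Fin n) (Fin n) ℂ), 0 ≤ r ∧
    z ∈ densityMatrices n ∧ w ∈ densityMatrices n ∧ (0 < r → z * w = 0) ∧
    schattenNorm q (((1 + r : ℝ) : ℂ) • z + (r : ℂ) • w) ≤ 1 ∧
    y = ((1 + r : ℝ) : ℂ) • z - (r : ℂ) • w}

/-- The Hilbert--Schmidt inner product `(x, y) = τ(x y*)`. -/
def hsInner (x y : Matrix (Fin n) (Fin n) ℂ) : ℂ := (x * y.conjTranspose).trace

/-- The unit vector `e₂ = n^(-1/2) I`. -/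
def hsUnit (n : ℕ) : Matrix (Fin n) (Fin n) ℂ := (((√(n : ℝ))⁻¹ : ℝ) : ℂ) • 1

/-- The Hilbert--Schmidt cone: hermitian `x` with `‖x‖_2 ≤ (n/(n-1))^(1/2) (x, e₂)`, where
`‖x‖_2 = (x, x)^(1/2)`; the inner product `(x, e₂)` is real for hermitian `x`. -/
def hsCone (n : ℕ) : Set (Matrix (Fin n) (Fin n) ℂ) :=
  {x | x.IsHermitian ∧
    √(hsInner x x).re ≤ √((n : ℝ) / ((n : ℝ) - 1)) * (hsInner x (hsUnit n)).re}

end ProjPos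

end

open ProjPos

/-! Everything rests on trace duality. For conjugate `p`, `q` one has `|τ(xy)| ≤ ‖x‖_p ‖y‖_q`, and
equality is attained for each `x` by some `y` in the unit `q`-ball. Singular value decompositions
reduce the inequality to Hölder's inequality for two sequences coupled by a doubly stochastic
matrix. Duality makes the Schatten functions norms and identifies `S_1` of `𝔖_p` with the hermitian
`y` such that `τ(y) = 1` and `‖y‖_q ≤ 1` (`traceFunctional_mem_epsStates_iff`).

Density matrices have trace norm one, so they lie in all these state sets; they separate the points
of `M_n`. In finite dimensions this makes the `ε`-norm an equivalent norm, and the only remaining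
issue for a function system is that the cone has no further states. A further state could be
separated from the closed convex set `S_1` by Hahn–Banach, and the separating functional yields an
element of the cone on which it is negative (`coneStates_schattenCone_subset`).

The remaining claims are computations with `S_1`. The Schatten norms decrease in `p`, hence the
cones increase. For `q = 1`, trace one and trace norm at most one force positivity, so `S_1` is
`S_τ` and the cone is `M_n^+`. For general `q`, the Jordan decomposition of the spectrum writes `y`
as `(1 + r) z - r w` with orthogonal densities, and orthogonality makes the sign before `w`
irrelevant for the norm. An `x` in the deformed cone is close in norm to a positive multiple of the
identity, close enough to absorb `‖y‖_1 ≤ n ≤ ε`. For `p = 2`, splitting off the scalar part turns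
the cone condition into Cauchy–Schwarz for the traceless parts. -/

open scoped ComplexOrder MatrixOrder ENNReal

noncomputable section

namespace ProjPos

/-! ### Hölder duality for finite sequences -/

section Sequences

variable {ι : Type*} [Fintype ι]

/-- The `ℓ^p` norm of a finite real sequence. -/
def vecNorm (p : ℝ≥0∞) (s : ι → ℝ) : ℝ := ‖(WithLp.toLp p s : PiLp p fun _ : ι => ℝ)‖

lemma vecNorm_eq_sum {p : ℝ≥0∞} (hp : 1 ≤ p) (hp' : p ≠ ∞) {s : ι → ℝ} (hs : ∀ i, 0 ≤ s i) :
    vecNorm p s = (∑ i, s i ^ p.toReal) ^ (1 / p.toReal) := by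
  have : 0 < p.toReal := ENNReal.toReal_pos (zero_lt_one.trans_le hp).ne' hp'
  rw [vecNorm, PiLp.norm_eq_sum this]
  simp [abs_of_nonneg (hs _)]

lemma vecNorm_top (s : ι → ℝ) : vecNorm ∞ s = ⨆ i, |s i| := by
  rw [vecNorm, PiLp.norm_eq_ciSup]
  simp

lemma vecNorm_one {s : ι → ℝ} (hs : ∀ i, 0 ≤ s i) : vecNorm 1 s = ∑ i, s i := by
  rw [vecNorm_eq_sum le_rfl ENNReal.one_ne_top hs]
  simp

lemma vecNorm_nonneg {p : ℝ≥0∞} (hp : 1 ≤ p) (s : ι → ℝ) : 0 ≤ vecNorm p s := by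
  have : Fact (1 ≤ p) := ⟨hp⟩
  exact norm_nonneg _

lemma vecNorm_eq_zero {p : ℝ≥0∞} (hp : 1 ≤ p) {s : ι → ℝ} (h : vecNorm p s = 0) : s = 0 := by
  have : Fact (1 ≤ p) := ⟨hp⟩
  have := norm_eq_zero.1 h
  exact congrArg WithLp.ofLp this

lemma le_vecNorm {p : ℝ≥0∞} (hp : 1 ≤ p) (s : ι → ℝ) (i : ι) : |s i| ≤ vecNorm p s := by
  have : Fact (1 ≤ p) := ⟨hp⟩
  exact PiLp.norm_apply_le (WithLp.toLp p s : PiLp p fun _ : ι => ℝ) i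

/-- With `M = ‖s‖_{p₁}`, each entry is at most `M`, so `s_i^{p₂} ≤ s_i^{p₁} M^{p₂ - p₁}`; the sum
over `i` is `M^{p₂}`. -/
lemma vecNorm_antitone {p₁ p₂ : ℝ≥0∞} (h₁ : 1 ≤ p₁) (h : p₁ ≤ p₂) {s : ι → ℝ}
    (hs : ∀ i, 0 ≤ s i) : vecNorm p₂ s ≤ vecNorm p₁ s := by
  have hle : ∀ i, s i ≤ vecNorm p₁ s := fun i => (le_abs_self _).trans (le_vecNorm h₁ s i)
  have hM := vecNorm_nonneg h₁ s
  by_cases ht : p₂ = ∞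
  · subst ht
    rw [vecNorm_top]
    refine Real.iSup_le (fun i => ?_) hM
    exact le_vecNorm h₁ s i
  have ht₁ : p₁ ≠ ∞ := ne_top_of_le_ne_top ht h
  have hr₁ : 0 < p₁.toReal := ENNReal.toReal_pos (zero_lt_one.trans_le h₁).ne' ht₁
  have hr : p₁.toReal ≤ p₂.toReal := ENNReal.toReal_mono ht h
  have hr₂ := hr₁.trans_le hr
  rcases hM.eq_or_lt with h0 | hpos
  · have : s = 0 := vecNorm_eq_zero h₁ h0.symm
    subst this
    have : Fact (1 ≤ p₂) := ⟨h₁.trans h⟩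
    rw [← h0]
    exact (norm_zero (E := PiLp p₂ fun _ : ι => ℝ)).le
  have hsum : ∑ i, s i ^ p₁.toReal = vecNorm p₁ s ^ p₁.toReal := by
    rw [vecNorm_eq_sum h₁ ht₁ hs, ← Real.rpow_mul (Finset.sum_nonneg fun i _ =>
      Real.rpow_nonneg (hs i) _), one_div_mul_cancel hr₁.ne', Real.rpow_one]
  rw [vecNorm_eq_sum (h₁.trans h) ht hs, one_div,
    Real.rpow_inv_le_iff_of_pos (Finset.sum_nonneg fun i _ => Real.rpow_nonneg (hs i) _) hM hr₂]
  calc ∑ i, s i ^ p₂.toReal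
      ≤ ∑ i, s i ^ p₁.toReal * vecNorm p₁ s ^ (p₂.toReal - p₁.toReal) := by
        refine Finset.sum_le_sum fun i _ => ?_
        rcases (hs i).eq_or_lt with h0 | hi
        · rw [← h0, Real.zero_rpow hr₂.ne', Real.zero_rpow hr₁.ne', zero_mul]
        · calc s i ^ p₂.toReal = s i ^ p₁.toReal * s i ^ (p₂.toReal - p₁.toReal) := by
                rw [← Real.rpow_add hi]; ring_nf
            _ ≤ _ := by
                gcongr
                exact hle i
    _ = vecNorm p₁ s ^ p₂.toReal := by
        rw [← Finset.sum_mul, hsum, ← Real.rpow_add hpos]; ring_nf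

lemma holderConjugate_cases {p q : ℝ≥0∞} (h : p.HolderConjugate q) :
    (p = ∞ ∧ q = 1) ∨ (p = 1 ∧ q = ∞) ∨
      (p ≠ ∞ ∧ q ≠ ∞ ∧ p.toReal.HolderConjugate q.toReal) := by
  by_cases hp : p = ∞
  · exact .inl ⟨hp, (ENNReal.HolderConjugate.eq_top_iff_eq_one p q).1 hp⟩
  have := h.symm
  by_cases hq : q = ∞
  · exact .inr (.inl ⟨(ENNReal.HolderConjugate.eq_top_iff_eq_one q p).1 hq, hq⟩)
  exact .inr (.inr ⟨hp, hq, ENNReal.HolderConjugate.toReal_of_ne_top hp hq⟩)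

lemma doublyStochastic_sum_mul_le_one_top {D : ι → ι → ℝ} (hD : ∀ i j, 0 ≤ D i j)
    (hrow : ∀ i, ∑ j, D i j = 1) {s t : ι → ℝ} (hs : ∀ i, 0 ≤ s i) :
    ∑ i, ∑ j, D i j * (s i * t j) ≤ vecNorm 1 s * vecNorm ∞ t := by
  rw [vecNorm_one hs, Finset.sum_mul]
  refine Finset.sum_le_sum fun i _ => ?_
  calc ∑ j, D i j * (s i * t j) ≤ ∑ j, D i j * (s i * vecNorm ∞ t) := by
        refine Finset.sum_le_sum fun j _ => ?_
        have := (le_abs_self _).trans (le_vecNorm (p := ∞) le_top t j)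
        have := hs i
        have := hD i j
        gcongr
    _ = s i * vecNorm ∞ t := by rw [← Finset.sum_mul, hrow, one_mul]

/-- Hölder's inequality weighted by a doubly stochastic matrix. -/
lemma doublyStochastic_sum_mul_le {p q : ℝ≥0∞} (h : p.HolderConjugate q) {D : ι → ι → ℝ}
    (hD : ∀ i j, 0 ≤ D i j) (hrow : ∀ i, ∑ j, D i j = 1) (hcol : ∀ j, ∑ i, D i j = 1)
    {s t : ι → ℝ} (hs : ∀ i, 0 ≤ s i) (ht : ∀ i, 0 ≤ t i) :
    ∑ i, ∑ j, D i j * (s i * t j) ≤ vecNorm p s * vecNorm q t := by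
  rcases holderConjugate_cases h with ⟨rfl, rfl⟩ | ⟨rfl, rfl⟩ | ⟨hp, hq, hpq⟩
  · rw [Finset.sum_comm, mul_comm]
    refine le_of_eq_of_le ?_ (doublyStochastic_sum_mul_le_one_top (D := fun i j => D j i)
      (fun i j => hD j i) hcol ht)
    simp only [mul_comm]
  · exact doublyStochastic_sum_mul_le_one_top hD hrow hs
  · have hp1 := ENNReal.HolderConjugate.one_le p q
    have := h.symm
    have hq1 := ENNReal.HolderConjugate.one_le q p
    rw [vecNorm_eq_sum hp1 hp hs, vecNorm_eq_sum hq1 hq ht]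
    set a := p.toReal
    set b := q.toReal
    -- The weight is split as `D = D^{1/a} D^{1/b}` and Hölder is applied on pairs of indices; the
    -- row and column sums then collapse the two factors to the norms of `s` and `t`.
    have key := Real.inner_le_Lp_mul_Lq_of_nonneg (Finset.univ : Finset (ι × ι))
      (f := fun x => D x.1 x.2 ^ (1 / a) * s x.1) (g := fun x => D x.1 x.2 ^ (1 / b) * t x.2) hpq
      (fun x _ => mul_nonneg (Real.rpow_nonneg (hD _ _) _) (hs _))
      (fun x _ => mul_nonneg (Real.rpow_nonneg (hD _ _) _) (ht _))
    simp only [Fintype.sum_prod_type] at key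
    refine le_of_eq_of_le ?_ (key.trans_eq ?_)
    · refine Finset.sum_congr rfl fun i _ => Finset.sum_congr rfl fun j _ => ?_
      have : D i j ^ (1 / a) * D i j ^ (1 / b) = D i j := by
        rw [← Real.rpow_add_of_nonneg (hD i j) hpq.one_div_nonneg hpq.symm.one_div_nonneg,
          one_div, one_div, hpq.inv_add_inv_eq_one, Real.rpow_one]
      conv_lhs => rw [← this]
      ring
    · congr 2
      · refine Finset.sum_congr rfl fun i _ => ?_
        rw [show s i ^ a = (∑ j, D i j) * s i ^ a by rw [hrow, one_mul], Finset.sum_mul]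
        refine Finset.sum_congr rfl fun j _ => ?_
        rw [Real.mul_rpow (Real.rpow_nonneg (hD _ _) _) (hs _), ← Real.rpow_mul (hD _ _),
          one_div_mul_cancel hpq.ne_zero, Real.rpow_one]
      · rw [Finset.sum_comm]
        refine Finset.sum_congr rfl fun i _ => ?_
        rw [show t i ^ b = (∑ j, D j i) * t i ^ b by rw [hcol, one_mul], Finset.sum_mul]
        refine Finset.sum_congr rfl fun j _ => ?_
        rw [Real.mul_rpow (Real.rpow_nonneg (hD _ _) _) (ht _), ← Real.rpow_mul (hD _ _),
          one_div_mul_cancel hpq.symm.ne_zero, Real.rpow_one]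

/-- Hölder is attained: by a point mass at a maximal entry for `p = ∞`, by the constant `1` for `p =
1`, and by the classical extremal sequence in between. -/
lemma exists_sum_mul_eq_vecNorm {p q : ℝ≥0∞} (h : p.HolderConjugate q) {s : ι → ℝ}
    (hs : ∀ i, 0 ≤ s i) :
    ∃ t : ι → ℝ, (∀ i, 0 ≤ t i) ∧ vecNorm q t ≤ 1 ∧ ∑ i, s i * t i = vecNorm p s := by
  classical
  rcases holderConjugate_cases h with ⟨rfl, rfl⟩ | ⟨rfl, rfl⟩ | ⟨hp, hq, hpq⟩
  · rcases isEmpty_or_nonempty ι with hι | hι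
    · exact ⟨0, by simp, by rw [vecNorm_one] <;> simp, by simp [vecNorm_top]⟩
    · obtain ⟨i₀, hi₀⟩ := exists_eq_ciSup_of_finite (f := fun i => |s i|)
      have h0 : ∀ i, 0 ≤ (Pi.single i₀ 1 : ι → ℝ) i := fun i => by
        by_cases h : i = i₀ <;> simp [h]
      refine ⟨Pi.single i₀ 1, h0, ?_, ?_⟩
      · rw [vecNorm_one h0]; simp
      · rw [vecNorm_top, ← hi₀, abs_of_nonneg (hs _)]; simp [Pi.single_apply]
  · refine ⟨1, by simp, ?_, ?_⟩
    · rw [vecNorm_top]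
      exact Real.iSup_le (by simp) zero_le_one
    · rw [vecNorm_one hs]; simp
  · have hp1 := ENNReal.HolderConjugate.one_le p q
    have := h.symm
    have hq1 := ENNReal.HolderConjugate.one_le q p
    obtain ⟨⟨g, hg, hgs⟩, -⟩ := NNReal.isGreatest_Lp Finset.univ (fun i => (s i).toNNReal) hpq
    refine ⟨fun i => g i, fun i => (g i).2, ?_, ?_⟩
    · rw [vecNorm_eq_sum hq1 hq (s := fun i => (g i : ℝ)) fun i => (g i).2]
      refine Real.rpow_le_one (Finset.sum_nonneg fun i _ => Real.rpow_nonneg (g i).2 _) ?_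
        hpq.symm.one_div_nonneg
      exact_mod_cast (show ∑ i, g i ^ q.toReal ≤ 1 from hg)
    · rw [vecNorm_eq_sum hp1 hp hs]
      have := congrArg NNReal.toReal hgs
      push_cast at this
      simpa [Real.coe_toNNReal _ (hs _)] using this

end Sequences

/-! ### Singular value decomposition -/

section SingularValues

variable {n : ℕ}

open Matrix

/-- The columns of `A` are pairwise orthogonal with lengths `|s i|`. Dividing the nonzero ones by `s
i` gives an orthonormal family; any extension to an orthonormal basis supplies the columns of `U`,
since those at `s i = 0` do not matter. -/
lemma exists_unitary_mul_diagonal (A : Matrix (Fin n) (Fin n) ℂ) (s : Fin n → ℝ)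
    (h : Aᴴ * A = diagonal fun i => ((s i ^ 2 : ℝ) : ℂ)) :
    ∃ U ∈ unitaryGroup (Fin n) ℂ, A = U * diagonal fun i => (s i : ℂ) := by
  have hin : ∀ i j, inner ℂ (WithLp.toLp 2 (A.col i) : EuclideanSpace ℂ (Fin n))
      (WithLp.toLp 2 (A.col j)) = if i = j then ((s i ^ 2 : ℝ) : ℂ) else 0 := by
    intro i j
    have := congrFun (congrFun h i) j
    rw [diagonal_apply] at this
    rw [← this, mul_apply, PiLp.inner_apply]
    simp [mul_comm]
  have hon : Orthonormal ℂ (({i | s i ≠ 0} : Set (Fin n)).domRestrict fun i =>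
      ((s i : ℂ)⁻¹ • (WithLp.toLp 2 (A.col i)) : EuclideanSpace ℂ (Fin n))) := by
    rw [orthonormal_iff_ite]
    rintro ⟨i, hi⟩ ⟨j, hj⟩
    simp only [Set.domRestrict_apply, inner_smul_left, inner_smul_right, hin, Subtype.mk.injEq]
    split_ifs with hij
    · subst hij
      have : (s i : ℂ) ≠ 0 := by exact_mod_cast hi
      simp
      field_simp
    · simp
  obtain ⟨b, hb⟩ := hon.exists_orthonormalBasis_extension_of_card_eq (by simp)
  refine ⟨of fun k i => b i k, ?_, ?_⟩
  · rw [mem_unitaryGroup_iff']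
    ext i j
    have := orthonormal_iff_ite.1 b.orthonormal i j
    rw [PiLp.inner_apply] at this
    rw [one_apply, ← this, mul_apply]
    simp [mul_comm]
  · ext k i
    rw [mul_diagonal, of_apply]
    by_cases hi : s i = 0
    · have h0 : (WithLp.toLp 2 (A.col i) : EuclideanSpace ℂ (Fin n)) = 0 := by
        rw [← inner_self_eq_zero (𝕜 := ℂ), hin]; simp [hi]
      have := congrFun (congrArg WithLp.ofLp h0) k
      simpa [hi] using this
    · have hi' : (s i : ℂ) ≠ 0 := by exact_mod_cast hi
      rw [hb i hi]
      simp
      field_simp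

lemma schattenNorm_top_of_svd {U V : Matrix (Fin n) (Fin n) ℂ} (hU : U ∈ unitaryGroup (Fin n) ℂ)
    (hV : V ∈ unitaryGroup (Fin n) ℂ) (s : Fin n → ℝ) :
    schattenNorm ∞ (U * diagonal (fun i => (s i : ℂ)) * Vᴴ) = vecNorm ∞ s := by
  open scoped Matrix.Norms.L2Operator in
  have key : ‖U * diagonal (fun i => (s i : ℂ)) * Vᴴ‖ = vecNorm ∞ s := by
    have hV' : Vᴴ ∈ unitary (Matrix (Fin n) (Fin n) ℂ) := Unitary.star_mem hV
    rw [CStarRing.norm_mul_mem_unitary _ hV', CStarRing.norm_mem_unitary_mul _ hU,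
      l2_opNorm_diagonal, vecNorm_top, Pi.norm_def, Finset.sup_univ_eq_ciSup, NNReal.coe_iSup]
    simp
  rw [schattenNorm, if_pos rfl, ← key]
  rfl

/-- The singular value decomposition, with the singular values computing the Schatten norms. -/
lemma exists_svd (x : Matrix (Fin n) (Fin n) ℂ) :
    ∃ U ∈ unitaryGroup (Fin n) ℂ, ∃ V ∈ unitaryGroup (Fin n) ℂ, ∃ s : Fin n → ℝ,
      (∀ i, 0 ≤ s i) ∧ x = U * diagonal (fun i => (s i : ℂ)) * Vᴴ ∧
      ∀ p : ℝ≥0∞, 1 ≤ p → schattenNorm p x = vecNorm p s := by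
  have hpos : (CFC.abs x).PosSemidef := nonneg_iff_posSemidef.1 (CFC.abs_nonneg x)
  have hh := hpos.isHermitian
  set V : Matrix (Fin n) (Fin n) ℂ := (hh.eigenvectorUnitary : Matrix (Fin n) (Fin n) ℂ) with hVdef
  have hV : V ∈ unitaryGroup (Fin n) ℂ := hh.eigenvectorUnitary.2
  have hVV : Vᴴ * V = 1 := mem_unitaryGroup_iff'.1 hV
  have hVV' : V * Vᴴ = 1 := mem_unitaryGroup_iff.1 hV
  set s := hh.eigenvalues with hs
  have hs0 : ∀ i, 0 ≤ s i := hpos.eigenvalues_nonneg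
  have habs : CFC.abs x = V * diagonal (fun i => (s i : ℂ)) * Vᴴ := hh.spectral_theorem
  have hxx : xᴴ * x = V * diagonal (fun i => ((s i ^ 2 : ℝ) : ℂ)) * Vᴴ := by
    have h1 : CFC.abs x * CFC.abs x = xᴴ * x := CFC.abs_mul_abs x
    rw [← h1]
    conv_lhs => rw [habs]
    calc V * diagonal (fun i => (s i : ℂ)) * Vᴴ * (V * diagonal (fun i => (s i : ℂ)) * Vᴴ)
        = V * diagonal (fun i => (s i : ℂ)) * (Vᴴ * V) * diagonal (fun i => (s i : ℂ)) * Vᴴ := by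
          simp only [Matrix.mul_assoc]
      _ = _ := by
          rw [hVV, Matrix.mul_one, Matrix.mul_assoc V, diagonal_mul_diagonal]
          simp [sq]
  -- In the eigenbasis of `|x|` the columns of `x V` are orthogonal, so the left unitary is found
  -- even when `|x|` is singular.
  obtain ⟨U, hU, hUA⟩ := exists_unitary_mul_diagonal (x * V) s (by
    rw [conjTranspose_mul, Matrix.mul_assoc, ← Matrix.mul_assoc xᴴ, hxx, Matrix.mul_assoc,
      hVV, Matrix.mul_one, ← Matrix.mul_assoc, hVV, Matrix.one_mul])
  have hx : x = U * diagonal (fun i => (s i : ℂ)) * Vᴴ := by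
    rw [← hUA, Matrix.mul_assoc, hVV', Matrix.mul_one]
  refine ⟨U, hU, V, hV, s, hs0, hx, fun p hp => ?_⟩
  by_cases hp' : p = ∞
  · subst hp'
    conv_lhs => rw [hx]
    exact schattenNorm_top_of_svd hU hV s
  · rw [schattenNorm, if_neg hp', vecNorm_eq_sum hp hp' hs0,
      CFC.rpow_eq_cfc_real (a := CFC.abs x) (ha := CFC.abs_nonneg x), hh.cfc_eq, IsHermitian.cfc,
      Unitary.conjStarAlgAut_apply, trace_mul_comm, ← Matrix.mul_assoc,
      Unitary.coe_star_mul_self, Matrix.one_mul, trace_diagonal]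
    congr 1
    rw [Complex.re_sum]
    rfl

end SingularValues

/-! ### Duality of the Schatten norms -/

section SchattenNorm

variable {n : ℕ}

open Matrix

lemma sum_row_norm_sq_of_unitary {A : Matrix (Fin n) (Fin n) ℂ} (hA : A ∈ unitaryGroup (Fin n) ℂ)
    (i : Fin n) : ∑ j, ‖A i j‖ ^ 2 = 1 := by
  have h := congrFun (congrFun (mem_unitaryGroup_iff.1 hA) i) i
  rw [one_apply_eq, mul_apply] at h
  have : ((∑ j, ‖A i j‖ ^ 2 : ℝ) : ℂ) = 1 := by
    rw [← h]
    push_cast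
    refine Finset.sum_congr rfl fun j _ => ?_
    rw [star_apply]
    exact (RCLike.mul_conj (A i j)).symm
  exact_mod_cast this

lemma sum_col_norm_sq_of_unitary {A : Matrix (Fin n) (Fin n) ℂ} (hA : A ∈ unitaryGroup (Fin n) ℂ)
    (j : Fin n) : ∑ i, ‖A i j‖ ^ 2 = 1 := by
  have h := sum_row_norm_sq_of_unitary (A := star A) (Unitary.star_mem hA) j
  simpa [star_apply] using h

/-- The trace is `∑ s_i A_ij t_j B_ji` with `A = V* U'` and `B = V'* U` unitary. By the
arithmetic-geometric mean, `|A_ij B_ji|` is at most the mean of `|A_ij|²` and `|B_ji|²`, and these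
means form a doubly stochastic matrix. -/
lemma norm_trace_mul_le_of_svd {p q : ℝ≥0∞} (h : p.HolderConjugate q)
    {U V U' V' : Matrix (Fin n) (Fin n) ℂ} (hU : U ∈ unitaryGroup (Fin n) ℂ)
    (hV : V ∈ unitaryGroup (Fin n) ℂ) (hU' : U' ∈ unitaryGroup (Fin n) ℂ)
    (hV' : V' ∈ unitaryGroup (Fin n) ℂ) {s t : Fin n → ℝ} (hs : ∀ i, 0 ≤ s i)
    (ht : ∀ i, 0 ≤ t i) :
    ‖(U * diagonal (fun i => (s i : ℂ)) * Vᴴ * (U' * diagonal (fun i => (t i : ℂ)) * V'ᴴ)).trace‖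
      ≤ vecNorm p s * vecNorm q t := by
  set A := Vᴴ * U' with hA
  set B := V'ᴴ * U with hB
  have hAu : A ∈ unitaryGroup (Fin n) ℂ := mul_mem (Unitary.star_mem hV) hU'
  have hBu : B ∈ unitaryGroup (Fin n) ℂ := mul_mem (Unitary.star_mem hV') hU
  have htr : (U * diagonal (fun i => (s i : ℂ)) * Vᴴ *
      (U' * diagonal (fun i => (t i : ℂ)) * V'ᴴ)).trace =
      ∑ i, ∑ j, (s i : ℂ) * A i j * ((t j : ℂ) * B j i) := by
    have : U * diagonal (fun i => (s i : ℂ)) * Vᴴ * (U' * diagonal (fun i => (t i : ℂ)) * V'ᴴ) =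
        U * (diagonal (fun i => (s i : ℂ)) * A * (diagonal (fun i => (t i : ℂ)) * V'ᴴ)) := by
      simp only [hA, Matrix.mul_assoc]
    rw [this, trace_mul_comm, Matrix.mul_assoc, Matrix.mul_assoc (diagonal fun i => (t i : ℂ)),
      ← hB]
    simp only [trace, diag_apply]
    refine Finset.sum_congr rfl fun i _ => ?_
    rw [mul_apply]
    refine Finset.sum_congr rfl fun j _ => ?_
    rw [diagonal_mul, diagonal_mul]
  have hle : ∀ i j, ‖(s i : ℂ) * A i j * ((t j : ℂ) * B j i)‖ ≤
      ((‖A i j‖ ^ 2 + ‖B j i‖ ^ 2) / 2) * (s i * t j) := by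
    intro i j
    simp only [norm_mul, Complex.norm_real, Real.norm_eq_abs, abs_of_nonneg (hs i),
      abs_of_nonneg (ht j)]
    have h1 := mul_nonneg (hs i) (ht j)
    have h2 := mul_le_mul_of_nonneg_right (two_mul_le_add_sq ‖A i j‖ ‖B j i‖) h1
    linarith
  rw [htr]
  calc ‖∑ i, ∑ j, (s i : ℂ) * A i j * ((t j : ℂ) * B j i)‖
      ≤ ∑ i, ∑ j, ((‖A i j‖ ^ 2 + ‖B j i‖ ^ 2) / 2) * (s i * t j) :=
        (norm_sum_le _ _).trans <| Finset.sum_le_sum fun i _ =>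
          (norm_sum_le _ _).trans <| Finset.sum_le_sum fun j _ => hle i j
    _ ≤ vecNorm p s * vecNorm q t := by
        refine doublyStochastic_sum_mul_le h (fun i j => by positivity) (fun i => ?_)
          (fun j => ?_) hs ht
        · rw [← Finset.sum_div, Finset.sum_add_distrib, sum_row_norm_sq_of_unitary hAu,
            sum_col_norm_sq_of_unitary hBu]
          norm_num
        · rw [← Finset.sum_div, Finset.sum_add_distrib, sum_col_norm_sq_of_unitary hAu,
            sum_row_norm_sq_of_unitary hBu]
          norm_num

/-- Hölder's inequality for the Schatten norms. -/
lemma norm_trace_mul_le {p q : ℝ≥0∞} (h : p.HolderConjugate q) (x y : Matrix (Fin n) (Fin n) ℂ) :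
    ‖(x * y).trace‖ ≤ schattenNorm p x * schattenNorm q y := by
  have hp := ENNReal.HolderConjugate.one_le p q
  have := h.symm
  have hq := ENNReal.HolderConjugate.one_le q p
  obtain ⟨U, hU, V, hV, s, hs, hx, hxn⟩ := exists_svd x
  obtain ⟨U', hU', V', hV', t, ht, hy, hyn⟩ := exists_svd y
  rw [hxn p hp, hyn q hq]
  conv_lhs => rw [hx, hy]
  exact norm_trace_mul_le_of_svd h hU hV hU' hV' hs ht

lemma trace_mul_of_svd {U V : Matrix (Fin n) (Fin n) ℂ} (hU : U ∈ unitaryGroup (Fin n) ℂ)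
    (hV : V ∈ unitaryGroup (Fin n) ℂ) (s t : Fin n → ℝ) :
    (U * diagonal (fun i => (s i : ℂ)) * Vᴴ * (V * diagonal (fun i => (t i : ℂ)) * Uᴴ)).trace =
      ((∑ i, s i * t i : ℝ) : ℂ) := by
  have hUU : Uᴴ * U = 1 := mem_unitaryGroup_iff'.1 hU
  have hVV : Vᴴ * V = 1 := mem_unitaryGroup_iff'.1 hV
  have : U * diagonal (fun i => (s i : ℂ)) * Vᴴ * (V * diagonal (fun i => (t i : ℂ)) * Uᴴ) =
      U * (diagonal (fun i => (s i : ℂ)) * (Vᴴ * V) * diagonal (fun i => (t i : ℂ)) * Uᴴ) := by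
    simp only [Matrix.mul_assoc]
  rw [this, trace_mul_comm, hVV, Matrix.mul_one, Matrix.mul_assoc, hUU, Matrix.mul_one,
    diagonal_mul_diagonal, trace_diagonal]
  push_cast
  rfl

/-- Pairing with `V diag(g) U*`, where `g` is norming for `s`, recovers `‖s‖_p` from the first
decomposition, while the second bounds the same trace by `‖t‖_p`. Hence the Schatten norm can be
read off from any singular value decomposition. -/
lemma vecNorm_le_of_svd_eq {p : ℝ≥0∞} (hp : 1 ≤ p)
    {U V U' V' : Matrix (Fin n) (Fin n) ℂ} (hU : U ∈ unitaryGroup (Fin n) ℂ)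
    (hV : V ∈ unitaryGroup (Fin n) ℂ) (hU' : U' ∈ unitaryGroup (Fin n) ℂ)
    (hV' : V' ∈ unitaryGroup (Fin n) ℂ) {s t : Fin n → ℝ} (hs : ∀ i, 0 ≤ s i)
    (ht : ∀ i, 0 ≤ t i)
    (heq : U * diagonal (fun i => (s i : ℂ)) * Vᴴ = U' * diagonal (fun i => (t i : ℂ)) * V'ᴴ) :
    vecNorm p s ≤ vecNorm p t := by
  have h := ENNReal.HolderConjugate.conjExponent hp
  obtain ⟨g, hg, hg1, hsg⟩ := exists_sum_mul_eq_vecNorm h hs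
  have h1 := norm_trace_mul_le_of_svd h hU' hV' hV hU ht hg
  rw [← heq, trace_mul_of_svd hU hV, hsg, Complex.norm_real] at h1
  exact (le_abs_self _).trans (h1.trans (mul_le_of_le_one_right (vecNorm_nonneg hp t) hg1))

lemma schattenNorm_of_svd {p : ℝ≥0∞} (hp : 1 ≤ p) {U V : Matrix (Fin n) (Fin n) ℂ}
    (hU : U ∈ unitaryGroup (Fin n) ℂ) (hV : V ∈ unitaryGroup (Fin n) ℂ) {s : Fin n → ℝ}
    (hs : ∀ i, 0 ≤ s i) :
    schattenNorm p (U * diagonal (fun i => (s i : ℂ)) * Vᴴ) = vecNorm p s := by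
  obtain ⟨U', hU', V', hV', t, ht, hx, hxn⟩ := exists_svd (U * diagonal (fun i => (s i : ℂ)) * Vᴴ)
  rw [hxn p hp]
  exact le_antisymm (vecNorm_le_of_svd_eq hp hU' hV' hU hV ht hs hx.symm)
    (vecNorm_le_of_svd_eq hp hU hV hU' hV' hs ht hx)

lemma exists_trace_mul_eq_schattenNorm {p q : ℝ≥0∞} (h : p.HolderConjugate q)
    (x : Matrix (Fin n) (Fin n) ℂ) :
    ∃ y, schattenNorm q y ≤ 1 ∧ (x * y).trace = (schattenNorm p x : ℂ) := by
  have hp := ENNReal.HolderConjugate.one_le p q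
  have := h.symm
  have hq := ENNReal.HolderConjugate.one_le q p
  obtain ⟨U, hU, V, hV, s, hs, hx, hxn⟩ := exists_svd x
  obtain ⟨g, hg, hg1, hsg⟩ := exists_sum_mul_eq_vecNorm h hs
  refine ⟨V * diagonal (fun i => (g i : ℂ)) * Uᴴ, ?_, ?_⟩
  · rwa [schattenNorm_of_svd hq hV hU hg]
  · rw [hxn p hp, ← hsg, ← trace_mul_of_svd hU hV, ← hx]

lemma schattenNorm_nonneg {p : ℝ≥0∞} (hp : 1 ≤ p) (x : Matrix (Fin n) (Fin n) ℂ) :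
    0 ≤ schattenNorm p x := by
  obtain ⟨-, -, -, -, s, -, -, hxn⟩ := exists_svd x
  exact hxn p hp ▸ vecNorm_nonneg hp s

lemma schattenNorm_antitone {p₁ p₂ : ℝ≥0∞} (h₁ : 1 ≤ p₁) (h : p₁ ≤ p₂)
    (x : Matrix (Fin n) (Fin n) ℂ) : schattenNorm p₂ x ≤ schattenNorm p₁ x := by
  obtain ⟨-, -, -, -, s, hs, -, hxn⟩ := exists_svd x
  rw [hxn _ h₁, hxn _ (h₁.trans h)]
  exact vecNorm_antitone h₁ h hs

/-- The unit ball of the Schatten `q`-norm is polar to that of the Schatten `p`-norm. -/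
lemma schattenNorm_le_one_iff {p q : ℝ≥0∞} (h : p.HolderConjugate q)
    (y : Matrix (Fin n) (Fin n) ℂ) :
    schattenNorm q y ≤ 1 ↔ ∀ x : Matrix (Fin n) (Fin n) ℂ, ‖(x * y).trace‖ ≤ schattenNorm p x := by
  have hp := ENNReal.HolderConjugate.one_le p q
  have := h.symm
  have hq := ENNReal.HolderConjugate.one_le q p
  constructor
  · exact fun hy x => (norm_trace_mul_le h x y).trans
      (mul_le_of_le_one_right (schattenNorm_nonneg hp x) hy)
  · intro hy
    obtain ⟨x, hx, hxy⟩ := exists_trace_mul_eq_schattenNorm h.symm y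
    have h1 := hy x
    rw [trace_mul_comm, hxy, Complex.norm_real] at h1
    exact (le_abs_self _).trans (h1.trans hx)

lemma schattenNorm_smul_le {p : ℝ≥0∞} (hp : 1 ≤ p) (a : ℂ) (x : Matrix (Fin n) (Fin n) ℂ) :
    schattenNorm p (a • x) ≤ ‖a‖ * schattenNorm p x := by
  have h := ENNReal.HolderConjugate.conjExponent hp
  obtain ⟨y, hy, hxy⟩ := exists_trace_mul_eq_schattenNorm h (a • x)
  have h1 := norm_trace_mul_le h x y
  rw [Matrix.smul_mul, trace_smul] at hxy
  calc schattenNorm p (a • x) ≤ ‖(schattenNorm p (a • x) : ℂ)‖ := by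
        rw [Complex.norm_real]; exact le_abs_self _
    _ = ‖a‖ * ‖(x * y).trace‖ := by rw [← hxy, norm_smul]
    _ ≤ ‖a‖ * schattenNorm p x := by
        gcongr
        exact h1.trans (mul_le_of_le_one_right (schattenNorm_nonneg hp x) hy)

/-- Subadditivity and homogeneity follow from duality, since the norm is a maximum of `|τ(xy)|` over
a fixed ball. The adjoint exchanges `U` and `V` and keeps the singular values. -/
lemma isStarNorm_schattenNorm {p : ℝ≥0∞} (hp : 1 ≤ p) :
    IsStarNorm (schattenNorm (n := n) p) where
  nonneg := schattenNorm_nonneg hp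
  eq_zero_iff x := by
    constructor
    · intro h0
      obtain ⟨U, -, V, -, s, -, hx, hxn⟩ := exists_svd x
      have : s = 0 := vecNorm_eq_zero hp (hxn p hp ▸ h0)
      subst this
      simpa using hx
    · rintro rfl
      refine le_antisymm ?_ (schattenNorm_nonneg hp _)
      simpa using schattenNorm_smul_le hp 0 (0 : Matrix (Fin n) (Fin n) ℂ)
  smul a x := by
    refine le_antisymm (schattenNorm_smul_le hp a x) ?_
    by_cases ha : a = 0
    · simpa [ha] using schattenNorm_nonneg hp _
    · have h1 := schattenNorm_smul_le hp a⁻¹ (a • x)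
      rw [inv_smul_smul₀ ha, norm_inv] at h1
      have : 0 < ‖a‖ := norm_pos_iff.2 ha
      rwa [← div_eq_inv_mul, le_div_iff₀' this] at h1
  add_le x x' := by
    have h := ENNReal.HolderConjugate.conjExponent hp
    obtain ⟨y, hy, hxy⟩ := exists_trace_mul_eq_schattenNorm h (x + x')
    rw [Matrix.add_mul, trace_add] at hxy
    calc schattenNorm p (x + x') ≤ ‖(schattenNorm p (x + x') : ℂ)‖ := by
          rw [Complex.norm_real]; exact le_abs_self _
      _ ≤ ‖(x * y).trace‖ + ‖(x' * y).trace‖ := by rw [← hxy]; exact norm_add_le _ _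
      _ ≤ _ := by
          gcongr
          · exact (norm_trace_mul_le h x y).trans
              (mul_le_of_le_one_right (schattenNorm_nonneg hp x) hy)
          · exact (norm_trace_mul_le h x' y).trans
              (mul_le_of_le_one_right (schattenNorm_nonneg hp x') hy)
  star x := by
    obtain ⟨U, hU, V, hV, s, hs, hx, hxn⟩ := exists_svd x
    have : star x = V * diagonal (fun i => (s i : ℂ)) * Uᴴ := by
      have hd : (diagonal fun i => (s i : ℂ))ᴴ = diagonal fun i => (s i : ℂ) := by
        rw [diagonal_conjTranspose]
        congr 1
        ext i
        simp
      rw [hx, star_eq_conjTranspose, conjTranspose_mul, conjTranspose_mul,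
        conjTranspose_conjTranspose, hd, Matrix.mul_assoc]
    rw [this, schattenNorm_of_svd hp hV hU hs, hxn p hp]

lemma schattenNorm_of_unitary_conj {p : ℝ≥0∞} (hp : 1 ≤ p) {W : Matrix (Fin n) (Fin n) ℂ}
    (hW : W ∈ unitaryGroup (Fin n) ℂ) (l : Fin n → ℝ) :
    schattenNorm p (W * diagonal (fun i => (l i : ℂ)) * Wᴴ) = vecNorm p fun i => |l i| := by
  -- The signs of the eigenvalues form a diagonal unitary; absorbed on the left, it turns the
  -- spectral decomposition into a singular value decomposition.
  let ε : Fin n → ℝ := fun i => if 0 ≤ l i then 1 else -1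
  have hε : (diagonal fun i => (ε i : ℂ)) ∈ unitaryGroup (Fin n) ℂ := by
    rw [mem_unitaryGroup_iff, star_eq_conjTranspose, diagonal_conjTranspose,
      diagonal_mul_diagonal, ← diagonal_one]
    congr 1
    ext i
    by_cases h : 0 ≤ l i <;> simp [ε, h]
  have : W * diagonal (fun i => (l i : ℂ)) =
      W * (diagonal fun i => (ε i : ℂ)) * diagonal fun i => ((|l i| : ℝ) : ℂ) := by
    rw [Matrix.mul_assoc, diagonal_mul_diagonal]
    congr 2
    ext i
    by_cases h : 0 ≤ l i
    · simp [ε, h, abs_of_nonneg h]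
    · simp [ε, h, abs_of_neg (not_le.1 h)]
  rw [this, schattenNorm_of_svd hp (mul_mem hW hε) hW fun i => abs_nonneg _]

lemma schattenNorm_one_matrix {p : ℝ≥0∞} (hp : 1 ≤ p) (hp' : p ≠ ∞) :
    schattenNorm p (1 : Matrix (Fin n) (Fin n) ℂ) = (n : ℝ) ^ (1 / p.toReal) := by
  have h := schattenNorm_of_unitary_conj hp (one_mem (unitaryGroup (Fin n) ℂ)) fun _ => 1
  rw [vecNorm_eq_sum hp hp' fun i => abs_nonneg _] at h
  simpa using h

end SchattenNorm

/-! ### Function systems from separating unit states -/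

section FunctionSystems

variable {V : Type*} [AddCommGroup V] [Module ℂ V]

/-- The space `V` regarded as normed by `N`. -/
def NormedBy (_ : V → ℝ) : Type _ := V

instance (N : V → ℝ) : AddCommGroup (NormedBy N) := inferInstanceAs (AddCommGroup V)
instance (N : V → ℝ) : Module ℂ (NormedBy N) := inferInstanceAs (Module ℂ V)
instance (N : V → ℝ) : Norm (NormedBy N) := ⟨N⟩
instance (N : V → ℝ) [FiniteDimensional ℂ V] : FiniteDimensional ℂ (NormedBy N) :=
  inferInstanceAs (FiniteDimensional ℂ V)

lemma t2Space_weakStar (S : Set (V →ₗ[ℂ] ℂ)) : T2Space (WeakStar S) := by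
  let ev : WeakStar S → V → ℂ := fun φ v => φ.1 v
  have hev : Topology.IsInducing ev := ⟨rfl⟩
  refine T2Space.of_injective_continuous (f := ev) (fun φ ψ h => ?_) hev.continuous
  exact Subtype.ext (LinearMap.ext fun v => congrFun h v)

lemma continuous_weakStar_eval (S : Set (V →ₗ[ℂ] ℂ)) (v : V) :
    Continuous fun φ : WeakStar S => φ.1 v := by
  have hev : Topology.IsInducing fun (φ : WeakStar S) (v : V) => φ.1 v := ⟨rfl⟩
  exact (continuous_apply v).comp hev.continuous

variable [StarAddMonoid V] {N N' : V → ℝ}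

lemma IsStarNorm.core (h : IsStarNorm N) : NormedSpace.Core ℂ (NormedBy N) where
  norm_nonneg := h.nonneg
  norm_smul := h.smul
  norm_triangle := h.add_le
  norm_eq_zero_iff := h.eq_zero_iff

/-- The identity map between two norms on a finite-dimensional space is a bounded operator. -/
lemma IsStarNorm.exists_le_mul [FiniteDimensional ℂ V] (h : IsStarNorm N) (h' : IsStarNorm N') :
    ∃ C : ℝ, 0 < C ∧ ∀ v, N' v ≤ C * N v := by
  let _ := NormedAddCommGroup.ofCore h.core
  let _ := NormedSpace.ofCore h.core
  let _ := NormedAddCommGroup.ofCore h'.core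
  let _ := NormedSpace.ofCore h'.core
  let f : NormedBy N →ₗ[ℂ] NormedBy N' := (LinearMap.id : V →ₗ[ℂ] V)
  obtain ⟨C, hC, hf⟩ := (LinearMap.toContinuousLinearMap f).bound
  exact ⟨C, hC, hf⟩

lemma IsStarNorm.normsEquivalent [FiniteDimensional ℂ V] (h : IsStarNorm N) (h' : IsStarNorm N') :
    NormsEquivalent N N' := by
  obtain ⟨C, hC, hle⟩ := h.exists_le_mul h'
  obtain ⟨D, hD, hle'⟩ := h'.exists_le_mul h
  refine ⟨D⁻¹, C, inv_pos.2 hD, hC, fun v => ⟨?_, hle v⟩⟩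
  rw [inv_mul_le_iff₀ hD]
  exact hle' v

lemma IsStarNorm.map_zero (h : IsStarNorm N) : N 0 = 0 := (h.eq_zero_iff 0).2 rfl

variable {e : V}

lemma norm_le_of_mem_epsStates {φ : V →ₗ[ℂ] ℂ} (hφ : φ ∈ epsStates N e 1) (v : V) :
    ‖φ v‖ ≤ N v := by
  simpa using hφ.2.2 v

lemma norm_le_epsNorm {φ : V →ₗ[ℂ] ℂ} (hφ : φ ∈ epsStates N e 1) (v : V) :
    ‖φ v‖ ≤ epsNorm N e 1 v := by
  refine le_ciSup (f := fun φ : epsStates N e 1 => ‖φ.1 v‖) ⟨N v, ?_⟩ ⟨φ, hφ⟩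
  rintro _ ⟨ψ, rfl⟩
  exact norm_le_of_mem_epsStates ψ.2 v

lemma epsNorm_le {v : V} {c : ℝ} (hc : 0 ≤ c) (h : ∀ φ ∈ epsStates N e 1, ‖φ v‖ ≤ c) :
    epsNorm N e 1 v ≤ c :=
  Real.iSup_le (fun φ => h φ.1 φ.2) hc

lemma epsNorm_nonneg (v : V) : 0 ≤ epsNorm N e 1 v :=
  Real.iSup_nonneg fun _ => norm_nonneg _

lemma isStarNorm_epsNorm (hsep : ∀ v : V, (∀ φ ∈ epsStates N e 1, φ v = 0) → v = 0) :
    IsStarNorm (epsNorm N e 1) where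
  nonneg := epsNorm_nonneg
  eq_zero_iff v := by
    constructor
    · exact fun h => hsep v fun φ hφ => norm_le_zero_iff.1 (h ▸ norm_le_epsNorm hφ v)
    · rintro rfl
      simp [epsNorm]
  smul a v := by
    simp only [epsNorm, map_smul, smul_eq_mul, norm_mul]
    exact (Real.mul_iSup_of_nonneg (norm_nonneg a) _).symm
  add_le v w := by
    refine epsNorm_le (add_nonneg (epsNorm_nonneg v) (epsNorm_nonneg w)) fun φ hφ => ?_
    rw [map_add]
    exact (norm_add_le _ _).trans (add_le_add (norm_le_epsNorm hφ v) (norm_le_epsNorm hφ w))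
  star v := by
    unfold epsNorm
    congr 1
    ext φ
    rw [φ.2.1, norm_star]

lemma im_eq_zero_of_mem_epsStates {φ : V →ₗ[ℂ] ℂ} (hφ : φ ∈ epsStates N e 1) {v : V}
    (hv : IsSelfAdjoint v) : (φ v).im = 0 := by
  have := hφ.1 v
  rw [hv.star_eq] at this
  exact Complex.conj_eq_iff_im.1 this.symm

/-- All hermitian functionals in `S_1` take real values at `v`, so they vanish on `v - v*`, and they
separate points. -/
lemma isSelfAdjoint_of_forall_epsStates
    (hsep : ∀ v : V, (∀ φ ∈ epsStates N e 1, φ v = 0) → v = 0) {v : V}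
    (h : ∀ φ ∈ epsStates N e 1, 0 ≤ φ v) : IsSelfAdjoint v := by
  refine sub_eq_zero.1 (hsep _ fun φ hφ => ?_)
  rw [map_sub, hφ.1, sub_eq_zero]
  exact Complex.conj_eq_iff_im.2 (Complex.nonneg_iff.1 (h φ hφ)).2.symm

lemma isUnitalCone_projCone [StarModule ℂ V] (hN : IsUnitalStarNormed N e)
    (hsep : ∀ v : V, (∀ φ ∈ epsStates N e 1, φ v = 0) → v = 0) :
    IsUnitalCone N e (projCone N e 1) where
  hermitian v hv := hv.1
  zero_mem := ⟨.zero V, fun φ _ => by simp⟩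
  add_mem v hv w hw := ⟨hv.1.add hw.1, fun φ hφ => by
    rw [map_add]; exact add_nonneg (hv.2 φ hφ) (hw.2 φ hφ)⟩
  smul_mem r hr v hv := ⟨by
    rw [IsSelfAdjoint, star_smul, hv.1.star_eq, Complex.star_def, Complex.conj_ofReal],
    fun φ hφ => by
      rw [map_smul, smul_eq_mul]
      exact mul_nonneg (by exact_mod_cast hr) (hv.2 φ hφ)⟩
  separated v hv hv' := hsep v fun φ hφ => by
    have := hv'.2 φ hφ
    rw [map_neg, neg_nonneg] at this
    exact le_antisymm this (hv.2 φ hφ)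
  closed v hv := by
    have key : ∀ φ ∈ epsStates N e 1, 0 ≤ φ v := by
      intro φ hφ
      refine (isClosed_Ici (a := (0 : ℂ))).closure_subset ?_
      rw [Metric.mem_closure_iff]
      intro δ hδ
      obtain ⟨w, hw, hd⟩ := hv δ hδ
      refine ⟨φ w, hw.2 φ hφ, ?_⟩
      rw [dist_eq_norm, ← map_sub]
      exact (norm_le_of_mem_epsStates hφ _).trans_lt hd
    exact ⟨isSelfAdjoint_of_forall_epsStates hsep key, key⟩
  absorbing v hv := by
    -- Unit states satisfy `φ(v) ≥ -N v` on hermitian `v`, so `r ≥ N v` suffices; the extra `1`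
    -- keeps the threshold positive.
    refine ⟨N v + 1, by have := hN.isStarNorm.nonneg v; linarith, fun r hr => ⟨?_, ?_⟩⟩
    · refine hv.add ?_
      rw [IsSelfAdjoint, star_smul, hN.unit_hermitian.star_eq, Complex.star_def,
        Complex.conj_ofReal]
    · intro φ hφ
      have h1 := norm_le_of_mem_epsStates hφ v
      have h2 := (Complex.abs_re_le_norm (φ v)).trans h1
      rw [map_add, map_smul, hφ.2.1, smul_eq_mul, mul_one, Complex.nonneg_iff]
      constructor
      · have := neg_abs_le (φ v).re
        simp
        linarith
      · simp [im_eq_zero_of_mem_epsStates hφ hv]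

/-- Banach–Alaoglu: evaluation embeds `S_1` in the product of the closed discs of radius `N v`, and
its image is cut out by closed pointwise conditions. -/
lemma compactSpace_weakStar_epsStates : CompactSpace (WeakStar (epsStates N e 1)) := by
  let ev : WeakStar (epsStates N e 1) → V → ℂ := fun φ v => φ.1 v
  have hev : Topology.IsInducing ev := ⟨rfl⟩
  have hrange : Set.range ev = {f : V → ℂ | (∀ v w, f (v + w) = f v + f w) ∧
      (∀ (a : ℂ) v, f (a • v) = a * f v) ∧ (∀ v, f (star v) = star (f v)) ∧ f e = 1 ∧
      ∀ v, ‖f v‖ ≤ N v} := by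
    ext f
    constructor
    · rintro ⟨φ, rfl⟩
      exact ⟨map_add φ.1, fun a v => map_smul φ.1 a v, φ.2.1, φ.2.2.1,
        norm_le_of_mem_epsStates φ.2⟩
    · rintro ⟨hadd, hsmul, hstar, he, hle⟩
      exact ⟨⟨⟨⟨f, hadd⟩, hsmul⟩, hstar, he, fun v => by simpa using hle v⟩, rfl⟩
  have hclosed : IsClosed (Set.range ev) := by
    rw [hrange]
    simp only [Set.ofPred_and, Set.ofPred_forall]
    refine IsClosed.inter (isClosed_iInter fun v => isClosed_iInter fun w => ?_) <|
      IsClosed.inter (isClosed_iInter fun a => isClosed_iInter fun v => ?_) <|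
      IsClosed.inter (isClosed_iInter fun v => ?_) <| IsClosed.inter ?_ <|
      isClosed_iInter fun v => ?_
    · exact isClosed_eq (by fun_prop) (by fun_prop)
    · exact isClosed_eq (by fun_prop) (by fun_prop)
    · exact isClosed_eq (by fun_prop) (by fun_prop)
    · exact isClosed_eq (by fun_prop) (by fun_prop)
    · exact isClosed_le (by fun_prop) (by fun_prop)
  have hcompact : IsCompact (Set.range ev) := by
    refine IsCompact.of_isClosed_subset
      (isCompact_univ_pi fun v : V => isCompact_closedBall (0 : ℂ) (N v)) hclosed ?_
    rw [hrange]
    intro f hf v _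
    simpa using hf.2.2.2.2 v
  rw [← isCompact_univ_iff, hev.isCompact_iff, Set.image_univ]
  exact hcompact

lemma isConcreteFunctionSystemOn_epsStates
    (hsep : ∀ v : V, (∀ φ ∈ epsStates N e 1, φ v = 0) → v = 0)
    (hequiv : NormsEquivalent N (epsNorm N e 1)) :
    IsConcreteFunctionSystemOn N e (projCone N e 1) (epsStates N e 1) where
  compact := compactSpace_weakStar_epsStates
  hausdorff := t2Space_weakStar _
  representation := by
    let Φ : V →ₗ[ℂ] C(WeakStar (epsStates N e 1), ℂ) :=
      { toFun := fun v => ⟨fun φ => φ.1 v, continuous_weakStar_eval _ v⟩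
        map_add' := fun v w => by ext φ; exact map_add φ.1 v w
        map_smul' := fun a v => by ext φ; exact map_smul φ.1 a v }
    refine ⟨Φ, fun v φ => rfl, ?_, ?_, ?_, ?_, hequiv⟩
    · rw [injective_iff_map_eq_zero]
      exact fun v hv => hsep v fun φ hφ => DFunLike.congr_fun hv ⟨φ, hφ⟩
    · ext φ
      exact φ.2.2.1
    · intro v
      ext φ
      exact φ.2.1 v
    · intro v
      rw [ContinuousMap.le_def]
      constructor
      · exact fun hv φ => hv.2 φ.1 φ.2
      · intro hv
        have key : ∀ φ ∈ epsStates N e 1, 0 ≤ φ v := fun φ hφ => hv ⟨φ, hφ⟩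
        exact ⟨isSelfAdjoint_of_forall_epsStates hsep key, key⟩

/-- The `ε`-norm is dominated by `N`, so passing to it adds no states; by its definition as a
supremum it loses none. -/
lemma epsStates_epsNorm (hN : IsStarNorm N) :
    epsStates (epsNorm N e 1) e 1 = epsStates N e 1 := by
  ext φ
  constructor
  · intro hφ
    refine ⟨hφ.1, hφ.2.1, fun v => (hφ.2.2 v).trans ?_⟩
    rw [one_mul, one_mul]
    exact epsNorm_le (hN.nonneg v) fun ψ hψ => norm_le_of_mem_epsStates hψ v
  · exact fun hφ => ⟨hφ.1, hφ.2.1, fun v => by rw [one_mul]; exact norm_le_epsNorm hφ v⟩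

/-- In finite dimensions, a unital `*`-normed space whose unit states separate the points and
exhaust the states of the projective cone becomes a function system. -/
lemma isProjectiveFunctionSystem_of_separating [StarModule ℂ V] [FiniteDimensional ℂ V]
    (hN : IsUnitalStarNormed N e)
    (hsep : ∀ v : V, (∀ φ ∈ epsStates N e 1, φ v = 0) → v = 0)
    (hstates : coneStates e (projCone N e 1) ⊆ epsStates N e 1) :
    IsProjectiveFunctionSystem N e 1 := by
  have hnorm := isStarNorm_epsNorm hsep
  have hequiv := hN.isStarNorm.normsEquivalent hnorm
  have heq := epsStates_epsNorm (e := e) hN.isStarNorm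
  exact
    { isUnitalCone := isUnitalCone_projCone hN hsep
      coneStates_eq := hstates.antisymm fun φ hφ => ⟨hφ.2.1, fun v hv => hv.2 φ hφ⟩
      abstract_system :=
        { isUnitalStarNormed := ⟨hnorm, hN.unit_hermitian, hN.unit_ne_zero,
            by rw [heq]; exact hN.states_nonempty⟩
          ball_eq_polar := fun v => by
            rw [heq]
            exact ⟨fun h φ hφ => (norm_le_epsNorm hφ v).trans h, epsNorm_le zero_le_one⟩ }
      abstract_states := heq
      concrete := isConcreteFunctionSystemOn_epsStates hsep hequiv
      norm_equiv := hequiv }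

/-- For hermitian `w`, absorption puts `w + r e` in the cone, so `φ(w) + r` is nonnegative and
`φ(w)` is real. The general case follows from the real and imaginary parts of `v`. -/
lemma IsUnitalCone.map_star_of_mem_coneStates [StarModule ℂ V]
    {c : Set V} (hc : IsUnitalCone N e c) {φ : V →ₗ[ℂ] ℂ} (hφ : φ ∈ coneStates e c) (v : V) :
    φ (star v) = star (φ v) := by
  have hreal : ∀ w : V, IsSelfAdjoint w → star (φ w) = φ w := by
    intro w hw
    obtain ⟨r, -, hr⟩ := hc.absorbing w hw
    have h := (Complex.nonneg_iff.1 (hφ.2 _ (hr r le_rfl))).2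
    rw [map_add, map_smul, hφ.1] at h
    exact Complex.conj_eq_iff_im.2 (by simpa using h.symm)
  have hv := realPart_add_I_smul_imaginaryPart v
  have h1 := hreal _ (realPart v).2
  have h2 := hreal _ (imaginaryPart v).2
  conv_lhs => rw [← hv]
  conv_rhs => rw [← hv]
  rw [star_add, star_smul, (realPart v).2.star_eq, (imaginaryPart v).2.star_eq, map_add, map_add,
    map_smul, map_smul, star_add, smul_eq_mul, smul_eq_mul, star_mul', h1, h2]

end FunctionSystems

/-! ### States of the Schatten cones as matrices -/

section MatrixStates

variable {n : ℕ}

open Matrix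

lemma traceFunctional_apply (x y : Matrix (Fin n) (Fin n) ℂ) :
    traceFunctional y x = (x * y).trace := rfl

lemma traceFunctional_injective :
    Function.Injective (traceFunctional : Matrix (Fin n) (Fin n) ℂ → _) := by
  intro y y' h
  ext i j
  have := LinearMap.congr_fun h (single j i 1)
  simpa [traceFunctional_apply, trace_single_mul] using this

lemma traceFunctional_surjective :
    Function.Surjective (traceFunctional : Matrix (Fin n) (Fin n) ℂ → _) := by
  intro φ
  refine ⟨of fun i j => φ (single j i 1), ?_⟩
  ext x
  rw [traceFunctional_apply]
  conv_rhs => rw [matrix_eq_sum_single x]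
  simp only [map_sum, trace, diag_apply, mul_apply, of_apply]
  refine Finset.sum_congr rfl fun i _ => Finset.sum_congr rfl fun j _ => ?_
  rw [← mul_one (x i j), ← smul_eq_mul (x i j) 1, ← smul_single, map_smul, smul_eq_mul,
    smul_eq_mul, mul_one]

lemma trace_mul_conjTranspose_left (x y : Matrix (Fin n) (Fin n) ℂ) :
    (xᴴ * y).trace = star (x * yᴴ).trace := by
  rw [← trace_conjTranspose, conjTranspose_mul, conjTranspose_conjTranspose, trace_mul_comm]

lemma trace_mul_im_eq_zero {x y : Matrix (Fin n) (Fin n) ℂ} (hx : x.IsHermitian)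
    (hy : y.IsHermitian) : (x * y).trace.im = 0 := by
  have := trace_mul_conjTranspose_left x y
  rw [hx.eq, hy.eq] at this
  exact Complex.conj_eq_iff_im.1 this.symm

/-- The hermitian matrices of trace one in the unit ball of the Schatten `q`-norm. -/
def unitBallStates (n : ℕ) (q : ℝ≥0∞) : Set (Matrix (Fin n) (Fin n) ℂ) :=
  {y | y.IsHermitian ∧ y.trace = 1 ∧ schattenNorm q y ≤ 1}

lemma traceFunctional_mem_epsStates_iff {p q : ℝ≥0∞} (h : p.HolderConjugate q)
    {y : Matrix (Fin n) (Fin n) ℂ} :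
    traceFunctional y ∈ epsStates (schattenNorm p) 1 1 ↔ y ∈ unitBallStates n q := by
  refine and_congr ?_ (and_congr ?_ ?_)
  · constructor
    · intro hy
      refine traceFunctional_injective (LinearMap.ext fun x => ?_)
      have h1 := hy xᴴ
      rw [star_eq_conjTranspose, conjTranspose_conjTranspose, traceFunctional_apply,
        traceFunctional_apply, trace_mul_conjTranspose_left, star_star] at h1
      exact h1.symm
    · intro hy x
      have := trace_mul_conjTranspose_left x y
      rwa [hy.eq] at this
  · rw [traceFunctional_apply, Matrix.one_mul]
  · rw [schattenNorm_le_one_iff h]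
    simp only [one_mul, traceFunctional_apply]

lemma epsStates_schattenNorm {p q : ℝ≥0∞} (h : p.HolderConjugate q) :
    epsStates (schattenNorm (n := n) p) 1 1 = traceFunctional '' unitBallStates n q := by
  ext φ
  obtain ⟨y, rfl⟩ := traceFunctional_surjective φ
  rw [traceFunctional_mem_epsStates_iff h, traceFunctional_injective.mem_set_image]

lemma mem_schattenCone_iff {p q : ℝ≥0∞} (h : p.HolderConjugate q)
    {x : Matrix (Fin n) (Fin n) ℂ} :
    x ∈ schattenCone n p ↔ x.IsHermitian ∧ ∀ y ∈ unitBallStates n q, 0 ≤ (x * y).trace.re := by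
  refine and_congr_right fun hx => ?_
  rw [epsStates_schattenNorm h, Set.forall_mem_image]
  refine forall₂_congr fun y hy => ?_
  rw [traceFunctional_apply, Complex.nonneg_iff, trace_mul_im_eq_zero hx hy.1]
  simp

lemma exists_spectral {y : Matrix (Fin n) (Fin n) ℂ} (hy : y.IsHermitian) :
    ∃ W ∈ unitaryGroup (Fin n) ℂ, ∃ l : Fin n → ℝ,
      y = W * diagonal (fun i => (l i : ℂ)) * Wᴴ :=
  ⟨_, hy.eigenvectorUnitary.2, hy.eigenvalues, hy.spectral_theorem⟩

lemma trace_unitary_conj {W : Matrix (Fin n) (Fin n) ℂ} (hW : W ∈ unitaryGroup (Fin n) ℂ)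
    (l : Fin n → ℝ) : (W * diagonal (fun i => (l i : ℂ)) * Wᴴ).trace = ((∑ i, l i : ℝ) : ℂ) := by
  have hWW : Wᴴ * W = 1 := mem_unitaryGroup_iff'.1 hW
  rw [trace_mul_comm, ← Matrix.mul_assoc, hWW, Matrix.one_mul, trace_diagonal]
  push_cast
  rfl

lemma isHermitian_unitary_conj (W : Matrix (Fin n) (Fin n) ℂ) (l : Fin n → ℝ) :
    (W * diagonal (fun i => (l i : ℂ)) * Wᴴ).IsHermitian := by
  refine isHermitian_mul_mul_conjTranspose W ?_
  rw [IsHermitian, diagonal_conjTranspose]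
  congr 1
  ext i
  simp

lemma posSemidef_unitary_conj (W : Matrix (Fin n) (Fin n) ℂ) {l : Fin n → ℝ}
    (hl : ∀ i, 0 ≤ l i) : (W * diagonal (fun i => (l i : ℂ)) * Wᴴ).PosSemidef := by
  refine PosSemidef.mul_mul_conjTranspose_same ?_ W
  exact PosSemidef.diagonal fun i => show (0 : ℂ) ≤ (l i : ℂ) by exact_mod_cast hl i

lemma mem_densityMatrices_unitary_conj {W : Matrix (Fin n) (Fin n) ℂ}
    (hW : W ∈ unitaryGroup (Fin n) ℂ) {l : Fin n → ℝ} (hl : ∀ i, 0 ≤ l i) (hsum : ∑ i, l i = 1) :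
    W * diagonal (fun i => (l i : ℂ)) * Wᴴ ∈ densityMatrices n :=
  ⟨posSemidef_unitary_conj W hl, by rw [trace_unitary_conj hW, hsum, Complex.ofReal_one]⟩

lemma single_nonneg (i j : Fin n) : 0 ≤ (Pi.single i 1 : Fin n → ℝ) j := by
  by_cases h : j = i <;> simp [h]

/-- The witness is the projection onto the `i`-th eigenvector. -/
lemma exists_density_trace_mul_eq {W : Matrix (Fin n) (Fin n) ℂ}
    (hW : W ∈ unitaryGroup (Fin n) ℂ) (l : Fin n → ℝ) (i : Fin n) :
    ∃ y ∈ densityMatrices n, ((W * diagonal (fun i => (l i : ℂ)) * Wᴴ) * y).trace = (l i : ℂ) := by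
  refine ⟨_, mem_densityMatrices_unitary_conj hW (single_nonneg i) (by simp), ?_⟩
  rw [trace_mul_of_svd hW hW]
  simp [Pi.single_apply]

lemma densityMatrices_eq : densityMatrices n = unitBallStates n 1 := by
  ext y
  constructor
  · intro hy
    obtain ⟨hpos, htr⟩ := hy
    refine ⟨hpos.isHermitian, htr, ?_⟩
    have hsp : y = (hpos.isHermitian.eigenvectorUnitary : Matrix (Fin n) (Fin n) ℂ) *
        diagonal (fun i => (hpos.isHermitian.eigenvalues i : ℂ)) *
        (hpos.isHermitian.eigenvectorUnitary : Matrix (Fin n) (Fin n) ℂ)ᴴ :=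
      hpos.isHermitian.spectral_theorem
    have hW := hpos.isHermitian.eigenvectorUnitary.2
    have htr' : ∑ i, hpos.isHermitian.eigenvalues i = 1 := by
      rw [hsp, trace_unitary_conj hW] at htr
      exact_mod_cast htr
    rw [hsp, schattenNorm_of_unitary_conj le_rfl hW, vecNorm_one fun i => abs_nonneg _, ← htr']
    exact Finset.sum_le_sum fun i _ => (abs_of_nonneg (hpos.eigenvalues_nonneg i)).le
  · rintro ⟨hy, htr, hle⟩
    obtain ⟨W, hW, l, rfl⟩ := exists_spectral hy
    rw [trace_unitary_conj hW] at htr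
    rw [schattenNorm_of_unitary_conj le_rfl hW, vecNorm_one fun i => abs_nonneg _] at hle
    have htr' : ∑ i, l i = 1 := by exact_mod_cast htr
    refine mem_densityMatrices_unitary_conj hW (fun i => ?_) htr'
    -- The sum of the `|l i|` is at most `1`, the sum of the `l i`, so no eigenvalue can be
    -- negative.
    have h0 : ∑ i, (|l i| - l i) = 0 := by
      refine le_antisymm ?_ (Finset.sum_nonneg fun i _ => sub_nonneg.2 (le_abs_self _))
      rw [Finset.sum_sub_distrib, htr']
      linarith
    have := (Finset.sum_eq_zero_iff_of_nonneg fun i _ => sub_nonneg.2 (le_abs_self (l i))).1 h0 i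
      (Finset.mem_univ i)
    linarith [abs_nonneg (l i)]

lemma densityMatrices_subset {q : ℝ≥0∞} (hq : 1 ≤ q) :
    densityMatrices n ⊆ unitBallStates n q := by
  rw [densityMatrices_eq]
  exact fun y hy => ⟨hy.1, hy.2.1, (schattenNorm_antitone le_rfl hq y).trans hy.2.2⟩

lemma densityMatrices_nonempty (hn : 0 < n) : (densityMatrices n).Nonempty :=
  ⟨_, mem_densityMatrices_unitary_conj (one_mem (unitaryGroup (Fin n) ℂ))
    (single_nonneg (⟨0, hn⟩ : Fin n)) (by simp)⟩

lemma posSemidef_of_forall_density {x : Matrix (Fin n) (Fin n) ℂ} (hx : x.IsHermitian)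
    (h : ∀ y ∈ densityMatrices n, 0 ≤ (x * y).trace.re) : x.PosSemidef := by
  obtain ⟨W, hW, l, rfl⟩ := exists_spectral hx
  refine posSemidef_unitary_conj W fun i => ?_
  obtain ⟨y, hy, hyi⟩ := exists_density_trace_mul_eq hW l i
  have := h y hy
  rwa [hyi, Complex.ofReal_re] at this

lemma trace_mul_re_nonneg_of_posSemidef {x y : Matrix (Fin n) (Fin n) ℂ} (hx : x.PosSemidef)
    (hy : y.PosSemidef) : 0 ≤ (x * y).trace.re := by
  have hsp := hy.isHermitian.spectral_theorem
  rw [Unitary.conjStarAlgAut_apply] at hsp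
  rw [hsp, ← Matrix.mul_assoc, trace_mul_comm, ← Matrix.mul_assoc, ← Matrix.mul_assoc, trace,
    Complex.re_sum]
  refine Finset.sum_nonneg fun i _ => ?_
  have hd := (hx.conjTranspose_mul_mul_same
    (hy.isHermitian.eigenvectorUnitary : Matrix (Fin n) (Fin n) ℂ)).diag_nonneg (i := i)
  have := mul_nonneg hd (show (0 : ℂ) ≤ (hy.isHermitian.eigenvalues i : ℂ) by
    exact_mod_cast hy.eigenvalues_nonneg i)
  rw [diag_apply, mul_diagonal]
  exact (Complex.nonneg_iff.1 this).1

lemma posSemidef_iff_forall_density {x : Matrix (Fin n) (Fin n) ℂ} :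
    x.PosSemidef ↔ x.IsHermitian ∧ ∀ y ∈ densityMatrices n, 0 ≤ (x * y).trace.re :=
  ⟨fun h => ⟨h.isHermitian, fun _ hy => trace_mul_re_nonneg_of_posSemidef h hy.1⟩,
    fun h => posSemidef_of_forall_density h.1 h.2⟩

lemma schattenCone_top : schattenCone n ∞ = posCone n := by
  ext x
  rw [mem_schattenCone_iff (p := ∞) (q := 1) inferInstance, ← densityMatrices_eq]
  exact posSemidef_iff_forall_density.symm

lemma eq_zero_of_forall_density_of_isHermitian {x : Matrix (Fin n) (Fin n) ℂ}
    (hx : x.IsHermitian) (h : ∀ y ∈ densityMatrices n, (x * y).trace = 0) : x = 0 := by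
  obtain ⟨W, hW, l, rfl⟩ := exists_spectral hx
  have hl : (fun i => (l i : ℂ)) = 0 := by
    ext i
    obtain ⟨y, hy, hyi⟩ := exists_density_trace_mul_eq hW l i
    rw [← hyi, h y hy, Pi.zero_apply]
  rw [hl]
  simp

lemma eq_zero_of_forall_density {x : Matrix (Fin n) (Fin n) ℂ}
    (h : ∀ y ∈ densityMatrices n, (x * y).trace = 0) : x = 0 := by
  have hstar : ∀ y ∈ densityMatrices n, (xᴴ * y).trace = 0 := fun y hy => by
    rw [trace_mul_conjTranspose_left, hy.1.isHermitian.eq, h y hy, star_zero]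
  have h1 : x + xᴴ = 0 := by
    refine eq_zero_of_forall_density_of_isHermitian (isHermitian_add_transpose_self x) ?_
    intro y hy
    rw [Matrix.add_mul, trace_add, h y hy, hstar y hy, add_zero]
  have h2 : Complex.I • (x - xᴴ) = 0 := by
    refine eq_zero_of_forall_density_of_isHermitian ?_ ?_
    · rw [IsHermitian, conjTranspose_smul, conjTranspose_sub, conjTranspose_conjTranspose,
        Complex.star_def, Complex.conj_I, neg_smul, ← smul_neg, neg_sub]
    · intro y hy
      rw [Matrix.smul_mul, trace_smul, Matrix.sub_mul, trace_sub, h y hy, hstar y hy, sub_zero,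
        smul_zero]
  have h3 : x - xᴴ = 0 := (smul_eq_zero.1 h2).resolve_left Complex.I_ne_zero
  have h4 : (2 : ℂ) • x = 0 := by
    have : (2 : ℂ) • x = (x + xᴴ) + (x - xᴴ) := by rw [two_smul]; abel
    rw [this, h1, h3, add_zero]
  exact (smul_eq_zero.1 h4).resolve_left two_ne_zero

lemma epsStates_schattenNorm_separating {p : ℝ≥0∞} (hp : 1 ≤ p) (x : Matrix (Fin n) (Fin n) ℂ)
    (h : ∀ φ ∈ epsStates (schattenNorm p) 1 1, φ x = 0) : x = 0 := by
  have hpq := ENNReal.HolderConjugate.conjExponent hp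
  have := hpq.symm
  refine eq_zero_of_forall_density fun y hy => ?_
  exact h (traceFunctional y) ((traceFunctional_mem_epsStates_iff hpq).2
    (densityMatrices_subset (ENNReal.HolderConjugate.one_le _ p) hy))

lemma isUnitalStarNormed_schattenNorm (hn : 0 < n) {p : ℝ≥0∞} (hp : 1 ≤ p) :
    IsUnitalStarNormed (schattenNorm (n := n) p) 1 where
  isStarNorm := isStarNorm_schattenNorm hp
  unit_hermitian := .one _
  unit_ne_zero := by
    have : Nonempty (Fin n) := ⟨⟨0, hn⟩⟩
    exact one_ne_zero
  states_nonempty := by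
    have hpq := ENNReal.HolderConjugate.conjExponent hp
    have := hpq.symm
    rw [epsStates_schattenNorm hpq]
    exact ((densityMatrices_nonempty hn).mono
      (densityMatrices_subset (ENNReal.HolderConjugate.one_le _ p))).image _

lemma convex_epsStates {V : Type*} [AddCommGroup V] [Module ℂ V] [StarAddMonoid V]
    (N : V → ℝ) (e : V) {a b : ℝ} (ha : 0 ≤ a) (hb : 0 ≤ b) (hab : a + b = 1)
    {φ ψ : V →ₗ[ℂ] ℂ} (hφ : φ ∈ epsStates N e 1) (hψ : ψ ∈ epsStates N e 1) :
    (a : ℂ) • φ + (b : ℂ) • ψ ∈ epsStates N e 1 := by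
  refine ⟨fun v => ?_, ?_, fun v => ?_⟩
  · simp [hφ.1 v, hψ.1 v]
  · simp [hφ.2.1, hψ.2.1]
    exact_mod_cast hab
  · simp only [LinearMap.add_apply, LinearMap.smul_apply, smul_eq_mul, one_mul]
    refine (norm_add_le _ _).trans ?_
    rw [norm_mul, norm_mul, Complex.norm_real, Complex.norm_real, Real.norm_of_nonneg ha,
      Real.norm_of_nonneg hb]
    have h1 := mul_le_mul_of_nonneg_left (norm_le_of_mem_epsStates hφ v) ha
    have h2 := mul_le_mul_of_nonneg_left (norm_le_of_mem_epsStates hψ v) hb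
    have : a * N v + b * N v = N v := by rw [← add_mul, hab, one_mul]
    linarith

lemma isClosed_traceFunctional_preimage_epsStates (p : ℝ≥0∞) :
    IsClosed (traceFunctional ⁻¹' epsStates (schattenNorm (n := n) p) 1 1) := by
  have hcont : ∀ x : Matrix (Fin n) (Fin n) ℂ, Continuous fun y => traceFunctional y x :=
    fun x => (continuous_const.matrix_mul continuous_id).matrix_trace
  have : traceFunctional ⁻¹' epsStates (schattenNorm (n := n) p) 1 1 =
      {y | (∀ x, traceFunctional y (star x) = star (traceFunctional y x)) ∧
        traceFunctional y 1 = 1 ∧ ∀ x, ‖traceFunctional y x‖ ≤ 1 * schattenNorm p x} := rfl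
  rw [this]
  simp only [Set.ofPred_and, Set.ofPred_forall]
  refine IsClosed.inter (isClosed_iInter fun x => ?_) <| IsClosed.inter ?_ <|
    isClosed_iInter fun x => ?_
  · exact isClosed_eq (hcont _) (hcont x).star
  · exact isClosed_eq (hcont 1) continuous_const
  · exact isClosed_le (hcont x).norm continuous_const

/-- The unit states exhaust the states of the Schatten cones. -/
lemma coneStates_schattenCone_subset (hn : 0 < n) {p : ℝ≥0∞} (hp : 1 ≤ p) :
    coneStates 1 (projCone (schattenNorm (n := n) p) 1 1) ⊆
      epsStates (schattenNorm p) 1 1 := by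
  intro φ hφ
  have hN := isUnitalStarNormed_schattenNorm hn hp
  have hstar := (isUnitalCone_projCone hN
    (epsStates_schattenNorm_separating hp)).map_star_of_mem_coneStates hφ
  obtain ⟨y, rfl⟩ := traceFunctional_surjective φ
  by_contra hy
  have : LocallyConvexSpace ℝ (Matrix (Fin n) (Fin n) ℂ) :=
    inferInstanceAs (LocallyConvexSpace ℝ (Fin n → Fin n → ℂ))
  -- If `y` is not a unit state, a real hyperplane strictly separates it from them: `Re f(y) < u <
  -- Re f(z)` for all unit states `z`.
  obtain ⟨f, u, hfy, hfK⟩ := RCLike.geometric_hahn_banach_point_closed (𝕜 := ℂ)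
    (t := traceFunctional ⁻¹' epsStates (schattenNorm (n := n) p) 1 1) (x := y) (by
      intro z hz w hw a b ha hb hab
      have := convex_epsStates _ _ ha hb hab hz hw
      rw [Set.mem_preimage]
      convert this using 1
      ext x
      simp [traceFunctional_apply, Matrix.mul_add]) (isClosed_traceFunctional_preimage_epsStates p) hy
  obtain ⟨b, hb⟩ := traceFunctional_surjective f.toLinearMap
  have hfb : ∀ z, f z = (z * b).trace := fun z => (LinearMap.congr_fun hb z).symm
  -- On hermitian `z` of trace one, `τ(az) = Re f(z) - u`: the hermitian part of `b` gives the real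
  -- part of `f`, and the trace turns the constant `u` into a multiple of the identity. Thus `a`
  -- lies in the cone but `y` is negative on it.
  set a : Matrix (Fin n) (Fin n) ℂ := (1 / 2 : ℂ) • (b + bᴴ) - (u : ℂ) • 1 with ha
  have hah : IsSelfAdjoint a := by
    rw [IsSelfAdjoint, ha, star_sub, star_smul, star_smul, star_add, star_one,
      star_eq_conjTranspose b, star_eq_conjTranspose bᴴ, conjTranspose_conjTranspose, add_comm]
    simp
  have key : ∀ z : Matrix (Fin n) (Fin n) ℂ,
      (∀ x, traceFunctional z (star x) = star (traceFunctional z x)) →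
      traceFunctional z 1 = 1 → (traceFunctional z a) = (((f z).re - u : ℝ) : ℂ) := by
    intro z hz hz1
    have h1 := hz b
    rw [star_eq_conjTranspose] at h1
    have h2 : traceFunctional z b = f z := by rw [hfb, trace_mul_comm, traceFunctional_apply]
    rw [ha, map_sub, map_smul, map_smul, map_add, h1, hz1, h2, Complex.star_def, Complex.add_conj]
    simp
  have hac : a ∈ projCone (schattenNorm (n := n) p) 1 1 := by
    refine ⟨hah, fun ψ hψ => ?_⟩
    obtain ⟨z, rfl⟩ := traceFunctional_surjective ψ
    rw [key z hψ.1 hψ.2.1]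
    have := hfK z hψ
    exact_mod_cast (sub_pos.2 this).le
  have h1 := hφ.2 a hac
  rw [key y hstar hφ.1] at h1
  have h2 : 0 ≤ (f y).re - u := by exact_mod_cast h1
  have h3 : (f y).re < u := hfy
  linarith

lemma isProjectiveFunctionSystem_schattenNorm (hn : 0 < n) {p : ℝ≥0∞} (hp : 1 ≤ p) :
    IsProjectiveFunctionSystem (schattenNorm (n := n) p) 1 1 :=
  isProjectiveFunctionSystem_of_separating (isUnitalStarNormed_schattenNorm hn hp)
    (epsStates_schattenNorm_separating hp) (coneStates_schattenCone_subset hn hp)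

lemma coneStates_schattenCone (hn : 0 < n) {p q : ℝ≥0∞} (h : p.HolderConjugate q) :
    coneStates 1 (schattenCone n p) = traceFunctional '' unitBallStates n q := by
  rw [← epsStates_schattenNorm h]
  exact (isProjectiveFunctionSystem_schattenNorm hn
    (ENNReal.HolderConjugate.one_le p q)).coneStates_eq

lemma coneStates_posCone (hn : 0 < n) :
    coneStates 1 (posCone n) = traceFunctional '' densityMatrices n := by
  rw [← schattenCone_top, densityMatrices_eq]
  exact coneStates_schattenCone hn inferInstance

/-- The norm decreases in `p`, so its dual unit ball shrinks, and fewer states impose fewer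
conditions. -/
lemma schattenCone_mono {p₁ p₂ : ℝ≥0∞} (h₁ : 1 ≤ p₁) (h : p₁ ≤ p₂) :
    schattenCone n p₁ ⊆ schattenCone n p₂ :=
  fun _ hx => ⟨hx.1, fun φ hφ => hx.2 φ ⟨hφ.1, hφ.2.1, fun v => (hφ.2.2 v).trans (by
    rw [one_mul, one_mul]; exact schattenNorm_antitone h₁ h v)⟩⟩

lemma one_div_schattenNorm_one_lt (hn : 1 < n) {p : ℝ≥0∞} (hp : 1 ≤ p) (hp' : p ≠ ∞) :
    1 / schattenNorm p (1 : Matrix (Fin n) (Fin n) ℂ) < 1 := by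
  rw [schattenNorm_one_matrix hp hp']
  have h0 : 0 < p.toReal := ENNReal.toReal_pos (zero_lt_one.trans_le hp).ne' hp'
  have h1 : 1 < (n : ℝ) ^ (1 / p.toReal) :=
    Real.one_lt_rpow (by exact_mod_cast hn) (by positivity)
  rw [div_lt_one (by linarith)]
  exact h1

end MatrixStates

/-! ### Differences of orthogonal density matrices -/

section OrthogonalDifferences

variable {n : ℕ}

open Matrix

/-- The Schatten norms of `x` depend only on `x* x`. -/
lemma schattenNorm_eq_of_conjTranspose_mul_self_eq {q : ℝ≥0∞} (hq : 1 ≤ q)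
    {x y : Matrix (Fin n) (Fin n) ℂ} (h : xᴴ * x = yᴴ * y) :
    schattenNorm q x = schattenNorm q y := by
  obtain ⟨U, hU, V, hV, s, hs, hx, hxn⟩ := exists_svd x
  have hUU : Uᴴ * U = 1 := mem_unitaryGroup_iff'.1 hU
  have hVV : Vᴴ * V = 1 := mem_unitaryGroup_iff'.1 hV
  have hVV' : V * Vᴴ = 1 := mem_unitaryGroup_iff.1 hV
  have hd : (diagonal fun i => (s i : ℂ))ᴴ = diagonal fun i => (s i : ℂ) := by
    rw [diagonal_conjTranspose]
    congr 1
    ext i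
    simp
  have hxV : x * V = U * diagonal fun i => (s i : ℂ) := by
    rw [hx, Matrix.mul_assoc, hVV, Matrix.mul_one]
  obtain ⟨U', hU', hy⟩ := exists_unitary_mul_diagonal (y * V) s (by
    have : (y * V)ᴴ * (y * V) = (x * V)ᴴ * (x * V) := by
      rw [conjTranspose_mul, conjTranspose_mul, Matrix.mul_assoc, ← Matrix.mul_assoc yᴴ, ← h]
      simp only [Matrix.mul_assoc]
    rw [this, hxV, conjTranspose_mul, hd, Matrix.mul_assoc, ← Matrix.mul_assoc Uᴴ, hUU,
      Matrix.one_mul, diagonal_mul_diagonal]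
    simp [sq])
  have hy' : y = U' * diagonal (fun i => (s i : ℂ)) * Vᴴ := by
    rw [← hy, Matrix.mul_assoc, hVV', Matrix.mul_one]
  rw [hxn q hq, hy', schattenNorm_of_svd hq hU' hV hs]

/-- Orthogonality removes the cross terms, the only place where the sign enters `x* x`. -/
lemma schattenNorm_add_eq_sub_of_mul_eq_zero {q : ℝ≥0∞} (hq : 1 ≤ q)
    {z w : Matrix (Fin n) (Fin n) ℂ} (hz : z.IsHermitian) (hw : w.IsHermitian)
    (hzw : z * w = 0) (a b : ℝ) :
    schattenNorm q ((a : ℂ) • z + (b : ℂ) • w) = schattenNorm q ((a : ℂ) • z - (b : ℂ) • w) := by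
  have hwz : w * z = 0 := by
    rw [← hz.eq, ← hw.eq, ← conjTranspose_mul, hzw, conjTranspose_zero]
  refine schattenNorm_eq_of_conjTranspose_mul_self_eq hq ?_
  simp [hz.eq, hw.eq, Matrix.add_mul, Matrix.mul_add, Matrix.sub_mul, Matrix.mul_sub, hzw, hwz]

lemma orthogonalDifferences_subset {q : ℝ≥0∞} (hq : 1 ≤ q) :
    orthogonalDifferences n q ⊆ unitBallStates n q := by
  rintro _ ⟨r, z, w, hz, hw, hzw, hle, rfl⟩
  have hzh := hz.1.isHermitian
  have hwh := hw.1.isHermitian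
  refine ⟨?_, ?_, ?_⟩
  · simp [IsHermitian, hzh.eq, hwh.eq]
  · rw [trace_sub, trace_smul, trace_smul, hz.2, hw.2]
    simp
  · rwa [← schattenNorm_add_eq_sub_of_mul_eq_zero hq hzh hwh hzw]

lemma orthogonalDifferencesNonneg_subset {q : ℝ≥0∞} (hq : 1 ≤ q) :
    orthogonalDifferencesNonneg n q ⊆ unitBallStates n q := by
  rintro _ ⟨r, z, w, hr, hz, hw, hzw, hle, rfl⟩
  rcases hr.eq_or_lt with rfl | hr
  · have : (((1 + 0 : ℝ) : ℂ) • z - ((0 : ℝ) : ℂ) • w) = z := by simp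
    rw [this]
    have : (((1 + 0 : ℝ) : ℂ) • z + ((0 : ℝ) : ℂ) • w) = z := by simp
    exact ⟨hz.1.isHermitian, hz.2, this ▸ hle⟩
  · exact orthogonalDifferences_subset hq ⟨r, z, w, hz, hw, hzw hr, hle, rfl⟩

lemma unitary_conj_mul {W : Matrix (Fin n) (Fin n) ℂ} (hW : W ∈ unitaryGroup (Fin n) ℂ)
    (f g : Fin n → ℝ) :
    W * diagonal (fun i => (f i : ℂ)) * Wᴴ * (W * diagonal (fun i => (g i : ℂ)) * Wᴴ) =
      W * diagonal (fun i => ((f i * g i : ℝ) : ℂ)) * Wᴴ := by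
  have hWW : Wᴴ * W = 1 := mem_unitaryGroup_iff'.1 hW
  calc _ = W * diagonal (fun i => (f i : ℂ)) * (Wᴴ * W) * diagonal (fun i => (g i : ℂ)) * Wᴴ := by
        simp only [Matrix.mul_assoc]
    _ = _ := by
        rw [hWW, Matrix.mul_one, Matrix.mul_assoc W, diagonal_mul_diagonal]
        simp

lemma smul_unitary_conj (W : Matrix (Fin n) (Fin n) ℂ) (a : ℝ) (f : Fin n → ℝ) :
    (a : ℂ) • (W * diagonal (fun i => (f i : ℂ)) * Wᴴ) =
      W * diagonal (fun i => ((a * f i : ℝ) : ℂ)) * Wᴴ := by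
  rw [← Matrix.smul_mul, ← Matrix.mul_smul, ← diagonal_smul]
  congr 3
  ext i
  simp

lemma sub_unitary_conj (W : Matrix (Fin n) (Fin n) ℂ) (f g : Fin n → ℝ) :
    W * diagonal (fun i => (f i : ℂ)) * Wᴴ - W * diagonal (fun i => (g i : ℂ)) * Wᴴ =
      W * diagonal (fun i => ((f i - g i : ℝ) : ℂ)) * Wᴴ := by
  rw [← Matrix.sub_mul, ← Matrix.mul_sub, diagonal_sub]
  simp

/-- A splitting of the eigenvalues of a hermitian matrix induces a splitting of the matrix into
orthogonal density matrices. -/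
lemma exists_orthogonal_densities {q : ℝ≥0∞} (hq : 1 ≤ q) {W : Matrix (Fin n) (Fin n) ℂ}
    (hW : W ∈ unitaryGroup (Fin n) ℂ) {l f g : Fin n → ℝ} {r : ℝ} (hf : ∀ i, 0 ≤ f i)
    (hg : ∀ i, 0 ≤ g i) (hfs : ∑ i, f i = 1) (hgs : ∑ i, g i = 1) (hfg : ∀ i, f i * g i = 0)
    (hl : ∀ i, l i = (1 + r) * f i - r * g i)
    (hle : schattenNorm q (W * diagonal (fun i => (l i : ℂ)) * Wᴴ) ≤ 1) :
    ∃ z ∈ densityMatrices n, ∃ w ∈ densityMatrices n, z * w = 0 ∧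
      schattenNorm q (((1 + r : ℝ) : ℂ) • z + (r : ℂ) • w) ≤ 1 ∧
      W * diagonal (fun i => (l i : ℂ)) * Wᴴ = ((1 + r : ℝ) : ℂ) • z - (r : ℂ) • w := by
  have hzw : W * diagonal (fun i => (f i : ℂ)) * Wᴴ * (W * diagonal (fun i => (g i : ℂ)) * Wᴴ)
      = 0 := by
    rw [unitary_conj_mul hW]
    simp only [hfg, Complex.ofReal_zero, diagonal_zero, Matrix.mul_zero, Matrix.zero_mul]
  have heq : W * diagonal (fun i => (l i : ℂ)) * Wᴴ =
      ((1 + r : ℝ) : ℂ) • (W * diagonal (fun i => (f i : ℂ)) * Wᴴ) -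
        (r : ℂ) • (W * diagonal (fun i => (g i : ℂ)) * Wᴴ) := by
    rw [smul_unitary_conj, smul_unitary_conj, sub_unitary_conj]
    simp only [hl]
  refine ⟨_, mem_densityMatrices_unitary_conj hW hf hfs, _,
    mem_densityMatrices_unitary_conj hW hg hgs, hzw, ?_, heq⟩
  rwa [schattenNorm_add_eq_sub_of_mul_eq_zero hq (isHermitian_unitary_conj W f)
    (isHermitian_unitary_conj W g) hzw, ← heq]

/-- Here `r` is the total mass of the negative part; the positive part then has mass `1 + r`, and
both are normalized. -/
lemma exists_jordan_decomposition {l : Fin n → ℝ} (hl : ∑ i, l i = 1) (hneg : ∃ i, l i < 0) :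
    ∃ (r : ℝ) (f g : Fin n → ℝ), 0 < r ∧ (∀ i, 0 ≤ f i) ∧ (∀ i, 0 ≤ g i) ∧ ∑ i, f i = 1 ∧
      ∑ i, g i = 1 ∧ (∀ i, f i * g i = 0) ∧ ∀ i, l i = (1 + r) * f i - r * g i := by
  obtain ⟨i₀, hi₀⟩ := hneg
  set r := ∑ i, (l i)⁻ with hr
  have hr0 : 0 < r := (negPart_pos hi₀).trans_le
    (Finset.single_le_sum (f := fun i => (l i)⁻) (fun i _ => negPart_nonneg _)
      (Finset.mem_univ i₀))
  have hpos : ∑ i, (l i)⁺ = 1 + r := by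
    rw [← hl, hr, ← Finset.sum_add_distrib]
    refine Finset.sum_congr rfl fun i _ => ?_
    linarith [posPart_sub_negPart (l i)]
  have hr1 : 0 < 1 + r := by linarith
  refine ⟨r, fun i => (l i)⁺ / (1 + r), fun i => (l i)⁻ / r, hr0,
    fun i => div_nonneg (posPart_nonneg _) hr1.le, fun i => div_nonneg (negPart_nonneg _) hr0.le,
    ?_, ?_, fun i => ?_, fun i => ?_⟩
  · rw [← Finset.sum_div, hpos, div_self hr1.ne']
  · rw [← Finset.sum_div, ← hr, div_self hr0.ne']
  · rw [div_mul_div_comm]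
    rcases le_total 0 (l i) with h | h
    · rw [negPart_eq_zero.2 h, mul_zero, zero_div]
    · rw [posPart_eq_zero.2 h, zero_mul, zero_div]
  · rw [mul_div_cancel₀ _ hr1.ne', mul_div_cancel₀ _ hr0.ne', posPart_sub_negPart]

/-- With `r = 0`, a density of full rank would leave no room for an orthogonal `w`. Negative `r` is
allowed, so one eigenvalue is split off: `r = -l i₀` and `w` is its eigenprojection. This fails only
if `l i₀ = 1`; then all other eigenvalues vanish, and `r = 0` works with `w` at a second index,
which exists because `n > 1`. -/
lemma exists_splitting_of_nonneg (hn : 1 < n) {l : Fin n → ℝ} (hl : ∑ i, l i = 1)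
    (hpos : ∀ i, 0 ≤ l i) :
    ∃ (r : ℝ) (f g : Fin n → ℝ), (∀ i, 0 ≤ f i) ∧ (∀ i, 0 ≤ g i) ∧ ∑ i, f i = 1 ∧
      ∑ i, g i = 1 ∧ (∀ i, f i * g i = 0) ∧ ∀ i, l i = (1 + r) * f i - r * g i := by
  let i₀ : Fin n := ⟨0, by omega⟩
  let i₁ : Fin n := ⟨1, hn⟩
  have h01 : i₁ ≠ i₀ := by simp [i₀, i₁]
  have hle : l i₀ ≤ 1 := hl ▸ Finset.single_le_sum (fun i _ => hpos i) (Finset.mem_univ i₀)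
  rcases hle.eq_or_lt with h1 | h1
  · have hz : ∀ i, i ≠ i₀ → l i = 0 := by
      have h2 : ∑ i ∈ Finset.univ.erase i₀, l i = 0 := by
        have := Finset.add_sum_erase Finset.univ l (Finset.mem_univ i₀)
        linarith
      intro i hi
      exact (Finset.sum_eq_zero_iff_of_nonneg fun i _ => hpos i).1 h2 i (by simp [hi])
    refine ⟨0, l, Pi.single i₁ 1, hpos, single_nonneg i₁, hl, by simp, fun i => ?_, by simp⟩
    by_cases hi : i = i₁
    · rw [hi, hz i₁ h01, zero_mul]
    · simp [hi]
  · have hc : 0 < 1 - l i₀ := by linarith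
    refine ⟨-l i₀, fun i => if i = i₀ then 0 else l i / (1 - l i₀), Pi.single i₀ 1, fun i => ?_,
      single_nonneg i₀, ?_, by simp, fun i => ?_, fun i => ?_⟩
    · dsimp only
      split_ifs
      · exact le_rfl
      · exact div_nonneg (hpos i) hc.le
    · rw [← Finset.add_sum_erase _ _ (Finset.mem_univ i₀)]
      have : ∑ i ∈ Finset.univ.erase i₀, (if i = i₀ then 0 else l i / (1 - l i₀)) =
          ∑ i ∈ Finset.univ.erase i₀, l i / (1 - l i₀) :=
        Finset.sum_congr rfl fun i hi => if_neg (Finset.ne_of_mem_erase hi)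
      rw [if_pos rfl, zero_add, this, ← Finset.sum_div, div_eq_one_iff_eq hc.ne']
      have := Finset.add_sum_erase Finset.univ l (Finset.mem_univ i₀)
      linarith
    · by_cases hi : i = i₀ <;> simp [hi]
    · by_cases hi : i = i₀
      · simp [hi]
      · simp only [hi, if_false, Pi.single_apply]
        field_simp
        ring

lemma orthogonalDifferences_eq (hn : 1 < n) {q : ℝ≥0∞} (hq : 1 ≤ q) :
    orthogonalDifferences n q = unitBallStates n q := by
  refine (orthogonalDifferences_subset hq).antisymm ?_
  rintro y ⟨hy, htr, hle⟩
  obtain ⟨W, hW, l, rfl⟩ := exists_spectral hy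
  rw [trace_unitary_conj hW] at htr
  have hl : ∑ i, l i = 1 := by exact_mod_cast htr
  obtain ⟨r, f, g, hf, hg, hfs, hgs, hfg, hfgl⟩ :
      ∃ (r : ℝ) (f g : Fin n → ℝ), (∀ i, 0 ≤ f i) ∧ (∀ i, 0 ≤ g i) ∧ ∑ i, f i = 1 ∧
        ∑ i, g i = 1 ∧ (∀ i, f i * g i = 0) ∧ ∀ i, l i = (1 + r) * f i - r * g i := by
    by_cases hneg : ∃ i, l i < 0
    · obtain ⟨r, f, g, -, h⟩ := exists_jordan_decomposition hl hneg
      exact ⟨r, f, g, h⟩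
    · push Not at hneg
      exact exists_splitting_of_nonneg hn hl hneg
  obtain ⟨z, hz, w, hw, hzw, hle', heq⟩ :=
    exists_orthogonal_densities hq hW hf hg hfs hgs hfg hfgl hle
  exact ⟨r, z, w, hz, hw, hzw, hle', heq⟩

lemma orthogonalDifferencesNonneg_eq {q : ℝ≥0∞} (hq : 1 ≤ q) :
    orthogonalDifferencesNonneg n q = unitBallStates n q := by
  refine (orthogonalDifferencesNonneg_subset hq).antisymm ?_
  rintro y ⟨hy, htr, hle⟩
  obtain ⟨W, hW, l, rfl⟩ := exists_spectral hy
  rw [trace_unitary_conj hW] at htr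
  have hl : ∑ i, l i = 1 := by exact_mod_cast htr
  by_cases hneg : ∃ i, l i < 0
  · obtain ⟨r, f, g, hr, hf, hg, hfs, hgs, hfg, hfgl⟩ := exists_jordan_decomposition hl hneg
    obtain ⟨z, hz, w, hw, hzw, hle', heq⟩ :=
      exists_orthogonal_densities hq hW hf hg hfs hgs hfg hfgl hle
    exact ⟨r, z, w, hr.le, hz, hw, fun _ => hzw, hle', heq⟩
  · push Not at hneg
    have hd := mem_densityMatrices_unitary_conj hW hneg hl
    -- At `r = 0` the second density is arbitrary, so `w = z` serves.
    exact ⟨0, _, _, le_rfl, hd, hd, fun h => (lt_irrefl _ h).elim, by simpa using hle, by simp⟩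

end OrthogonalDifferences

/-! ### The deformed cones -/

section DeformedCone

variable {n : ℕ}

open Matrix

lemma mem_deformedCone_iff {ε : ℝ} {x : Matrix (Fin n) (Fin n) ℂ} :
    x ∈ deformedCone n ε ↔ x.IsHermitian ∧ ∀ y ∈ densityMatrices n,
      schattenNorm ∞ x * ((ε - 1) / (ε + 1)) ≤ (x * y).trace.re := by
  refine and_congr_right fun hx => ?_
  rw [posSemidef_iff_forall_density]
  have hh : (x - ((schattenNorm ∞ x * ((ε - 1) / (ε + 1)) : ℝ) : ℂ) • 1).IsHermitian := by
    rw [IsHermitian, conjTranspose_sub, hx.eq, conjTranspose_smul, conjTranspose_one,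
      Complex.star_def, Complex.conj_ofReal]
  rw [and_iff_right hh]
  refine forall₂_congr fun y hy => ?_
  rw [Matrix.sub_mul, trace_sub, Matrix.smul_mul, Matrix.one_mul, trace_smul, hy.2, smul_eq_mul,
    mul_one, Complex.sub_re, Complex.ofReal_re, sub_nonneg]

lemma norm_trace_mul_density_le {y : Matrix (Fin n) (Fin n) ℂ} (hy : y ∈ densityMatrices n)
    (x : Matrix (Fin n) (Fin n) ℂ) : ‖(x * y).trace‖ ≤ schattenNorm ∞ x := by
  rw [densityMatrices_eq] at hy
  exact (norm_trace_mul_le (p := ∞) (q := 1) inferInstance x y).trans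
    (mul_le_of_le_one_right (schattenNorm_nonneg le_top x) hy.2.2)

lemma isUnitalCone_deformedCone {ε : ℝ} (hε : 1 ≤ ε) :
    IsUnitalCone (schattenNorm (n := n) ∞) 1 (deformedCone n ε) := by
  have hN := isStarNorm_schattenNorm (n := n) (p := ∞) le_top
  set k := (ε - 1) / (ε + 1) with hk
  have hk0 : 0 ≤ k := div_nonneg (by linarith) (by linarith)
  have hk1 : k < 1 := by rw [hk, div_lt_one (by linarith)]; linarith
  refine ⟨fun v hv => hv.1, ?_, ?_, ?_, ?_, ?_, ?_⟩
  · rw [mem_deformedCone_iff]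
    exact ⟨isHermitian_zero, fun y _ => by simp [hN.map_zero]⟩
  · intro v hv w hw
    rw [mem_deformedCone_iff] at hv hw ⊢
    refine ⟨hv.1.add hw.1, fun y hy => ?_⟩
    rw [Matrix.add_mul, trace_add, Complex.add_re]
    have h1 := hv.2 y hy
    have h2 := hw.2 y hy
    have h3 := mul_le_mul_of_nonneg_right (hN.add_le v w) hk0
    rw [← hk] at *
    linarith
  · intro r hr v hv
    rw [mem_deformedCone_iff] at hv ⊢
    refine ⟨?_, fun y hy => ?_⟩
    · rw [IsHermitian, conjTranspose_smul, hv.1.eq, Complex.star_def, Complex.conj_ofReal]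
    · rw [hN.smul, Complex.norm_real, Real.norm_of_nonneg hr, Matrix.smul_mul, trace_smul,
        smul_eq_mul, Complex.re_ofReal_mul, mul_assoc]
      exact mul_le_mul_of_nonneg_left (hv.2 y hy) hr
  · intro v hv hv'
    rw [mem_deformedCone_iff] at hv hv'
    refine eq_zero_of_forall_density fun y hy => Complex.ext ?_
      (trace_mul_im_eq_zero hv.1 hy.1.isHermitian)
    have h1 := hv.2 y hy
    have h2 := hv'.2 y hy
    rw [Matrix.neg_mul, trace_neg, Complex.neg_re] at h2
    have h3 := mul_nonneg (hN.nonneg v) hk0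
    have h4 := mul_nonneg (hN.nonneg (-v)) hk0
    rw [Complex.zero_re]
    linarith
  · intro v hv
    have hneg : ∀ w : Matrix (Fin n) (Fin n) ℂ, schattenNorm ∞ (-w) = schattenNorm ∞ w := by
      intro w
      have := hN.smul (-1) w
      rwa [neg_one_smul, norm_neg, norm_one, one_mul] at this
    rw [mem_deformedCone_iff]
    constructor
    · have h0 : schattenNorm ∞ (star v - v) = 0 := by
        refine le_antisymm (le_of_forall_pos_lt_add fun δ hδ => ?_) (hN.nonneg _)
        obtain ⟨w, hw, hd⟩ := hv (δ / 2) (by linarith)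
        have hws : star w = w := hw.1
        have heq : star v - v = star (v - w) + -(v - w) := by
          rw [star_sub, hws]; abel
        have := hN.add_le (star (v - w)) (-(v - w))
        rw [hneg, hN.star, ← heq] at this
        linarith
      exact sub_eq_zero.1 ((hN.eq_zero_iff _).1 h0)
    · intro y hy
      refine le_of_forall_pos_lt_add fun δ hδ => ?_
      obtain ⟨w, hw, hd⟩ := hv (δ / 2) (by linarith)
      have h1 := (mem_deformedCone_iff.1 hw).2 y hy
      have h2 := (Complex.abs_re_le_norm _).trans (norm_trace_mul_density_le hy (v - w))
      rw [Matrix.sub_mul, trace_sub, Complex.sub_re] at h2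
      have h3 := hN.add_le w (v - w)
      rw [add_sub_cancel] at h3
      have h4 := (abs_le.1 h2).1
      have h5 : schattenNorm ∞ v * k ≤ schattenNorm ∞ w * k + schattenNorm ∞ (v - w) := by
        have := mul_le_mul_of_nonneg_right h3 hk0
        have := mul_le_of_le_one_right (hN.nonneg (v - w)) hk1.le
        linarith
      rw [← hk] at *
      linarith
  · intro v hv
    have hv0 := hN.nonneg v
    have h1k : 0 < 1 - k := by linarith
    -- It suffices that `r - ‖v‖ ≥ k (‖v‖ + r)`, that is, `r (1 - k) ≥ ‖v‖ (1 + k)`; the extra `1`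
    -- makes the threshold positive.
    refine ⟨(schattenNorm ∞ v * (1 + k) + 1) / (1 - k), by positivity, fun r hr => ?_⟩
    have hr' : schattenNorm ∞ v * (1 + k) + 1 ≤ r * (1 - k) := (div_le_iff₀ h1k).1 hr
    have hr0 : 0 ≤ r := le_trans (by positivity) hr
    rw [mem_deformedCone_iff]
    refine ⟨?_, fun y hy => ?_⟩
    · have hvh : vᴴ = v := hv
      rw [IsHermitian, conjTranspose_add, conjTranspose_smul, conjTranspose_one, hvh,
        Complex.star_def, Complex.conj_ofReal]
    · rw [Matrix.add_mul, trace_add, Matrix.smul_mul, Matrix.one_mul, trace_smul, hy.2,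
        smul_eq_mul, mul_one, Complex.add_re, Complex.ofReal_re]
      have h1 := (abs_le.1 ((Complex.abs_re_le_norm _).trans (norm_trace_mul_density_le hy v))).1
      have h2 := hN.add_le v ((r : ℂ) • 1)
      have h3 : schattenNorm ∞ (1 : Matrix (Fin n) (Fin n) ℂ) ≤ 1 := by
        have h := schattenNorm_of_unitary_conj (p := ∞) le_top
          (one_mem (unitaryGroup (Fin n) ℂ)) fun _ => 1
        rw [vecNorm_top] at h
        simp only [Complex.ofReal_one, diagonal_one, Matrix.one_mul, conjTranspose_one] at h
        rw [h]
        exact Real.iSup_le (by simp) zero_le_one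
      rw [hN.smul, Complex.norm_real, Real.norm_of_nonneg hr0] at h2
      have h4 := mul_le_mul_of_nonneg_left h3 hr0
      have h5 : schattenNorm ∞ (v + (r : ℂ) • 1) * k ≤ (schattenNorm ∞ v + r) * k :=
        mul_le_mul_of_nonneg_right (by linarith) hk0
      rw [← hk] at *
      linarith

lemma schattenNorm_one_le_mul_top (y : Matrix (Fin n) (Fin n) ℂ) :
    schattenNorm 1 y ≤ n * schattenNorm ∞ y := by
  obtain ⟨-, -, -, -, s, hs, -, hyn⟩ := exists_svd y
  rw [hyn 1 le_rfl, hyn ∞ le_top, vecNorm_one hs]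
  refine (Finset.sum_le_card_nsmul _ _ (vecNorm ∞ s) fun i _ =>
    (le_abs_self _).trans (le_vecNorm le_top s i)).trans_eq ?_
  simp

/-- With `M = ‖x‖_∞`, the spectrum of `x` lies in an interval with upper end `M`, midpoint `M ε/(ε +
1)` and half-width `M/(ε + 1)`. Hence `τ(xy)` is at least the midpoint minus the half-width times
`‖y‖_1`, and `‖y‖_1 ≤ n ‖y‖_∞ ≤ ε`. -/
lemma deformedCone_subset {ε : ℝ} (hε0 : 0 ≤ ε) (hε : (n : ℝ) ≤ ε) :
    deformedCone n ε ⊆ schattenCone n 1 := by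
  intro x hx
  rw [mem_schattenCone_iff (p := 1) (q := ∞) inferInstance]
  refine ⟨hx.1, fun y hy => ?_⟩
  have hmem := (mem_deformedCone_iff.1 hx).2
  set M := schattenNorm ∞ x with hM
  have hM0 : 0 ≤ M := schattenNorm_nonneg le_top x
  have hε1 : 0 < ε + 1 := by linarith
  have hd : schattenNorm ∞ (x - ((M * (ε / (ε + 1)) : ℝ) : ℂ) • 1) ≤ M * (1 / (ε + 1)) := by
    obtain ⟨W, hW, l, hxl⟩ := exists_spectral hx.1
    have hWW : W * Wᴴ = 1 := mem_unitaryGroup_iff.1 hW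
    have hone : ((M * (ε / (ε + 1)) : ℝ) : ℂ) • (1 : Matrix (Fin n) (Fin n) ℂ) =
        W * diagonal (fun _ => ((M * (ε / (ε + 1)) : ℝ) : ℂ)) * Wᴴ := by
      have := smul_unitary_conj W (M * (ε / (ε + 1))) fun _ => 1
      simpa only [Complex.ofReal_one, diagonal_one, Matrix.mul_one, hWW, mul_one] using this
    have hle : ∀ i, |l i| ≤ M := fun i => by
      have := le_vecNorm (p := ∞) le_top (fun i => |l i|) i
      rwa [abs_abs, ← schattenNorm_of_unitary_conj le_top hW, ← hxl, ← hM] at this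
    have hge : ∀ i, M * ((ε - 1) / (ε + 1)) ≤ l i := fun i => by
      obtain ⟨z, hz, hzi⟩ := exists_density_trace_mul_eq hW l i
      have := hmem z hz
      rwa [hxl, hzi, Complex.ofReal_re] at this
    conv_lhs => rw [hxl]
    rw [hone, sub_unitary_conj, schattenNorm_of_unitary_conj le_top hW, vecNorm_top]
    refine Real.iSup_le (fun i => ?_) (by positivity)
    have e1 : M * ((ε - 1) / (ε + 1)) = M * (ε / (ε + 1)) - M * (1 / (ε + 1)) := by ring
    have e2 : M = M * (ε / (ε + 1)) + M * (1 / (ε + 1)) := by field_simp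
    rw [abs_abs, abs_le]
    have h1 := hge i
    have h2 := (abs_le.1 (hle i)).2
    constructor <;> linarith
  have hsplit : (x * y).trace.re = M * (ε / (ε + 1)) +
      ((x - ((M * (ε / (ε + 1)) : ℝ) : ℂ) • 1) * y).trace.re := by
    rw [Matrix.sub_mul, trace_sub, Matrix.smul_mul, Matrix.one_mul, trace_smul, hy.2.1,
      smul_eq_mul, mul_one, Complex.sub_re, Complex.ofReal_re]
    ring
  have hy1 : schattenNorm 1 y ≤ ε := by
    refine (schattenNorm_one_le_mul_top y).trans (le_trans ?_ hε)
    exact mul_le_of_le_one_right (Nat.cast_nonneg n) hy.2.2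
  have h1 := (Complex.abs_re_le_norm _).trans (norm_trace_mul_le (p := ∞) (q := 1) inferInstance
    (x - ((M * (ε / (ε + 1)) : ℝ) : ℂ) • 1) y)
  have h2 : schattenNorm ∞ (x - ((M * (ε / (ε + 1)) : ℝ) : ℂ) • 1) * schattenNorm 1 y ≤
      M * (1 / (ε + 1)) * ε :=
    mul_le_mul hd hy1 (schattenNorm_nonneg le_rfl y) (by positivity)
  have h3 := (abs_le.1 h1).1
  have h4 : M * (1 / (ε + 1)) * ε = M * (ε / (ε + 1)) := by ring
  rw [hsplit]
  linarith

end DeformedCone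

/-! ### The Hilbert–Schmidt cone -/

section HilbertSchmidt

variable {n : ℕ}

open Matrix

lemma schattenNorm_two_sq (x : Matrix (Fin n) (Fin n) ℂ) :
    schattenNorm 2 x ^ 2 = (hsInner x x).re := by
  obtain ⟨U, hU, V, hV, s, hs, hx, hxn⟩ := exists_svd x
  have hxs : xᴴ = V * diagonal (fun i => (s i : ℂ)) * Uᴴ := by
    rw [hx, conjTranspose_mul, conjTranspose_mul, conjTranspose_conjTranspose,
      diagonal_conjTranspose, Matrix.mul_assoc]
    congr 3
    ext i
    simp
  have htr := trace_mul_of_svd hU hV s s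
  rw [← hx, ← hxs] at htr
  rw [hsInner, htr, Complex.ofReal_re, hxn 2 one_le_two,
    vecNorm_eq_sum one_le_two ENNReal.ofNat_ne_top hs, ENNReal.toReal_ofNat, ← Real.sqrt_eq_rpow,
    Real.sq_sqrt (Finset.sum_nonneg fun i _ => Real.rpow_nonneg (hs i) _)]
  refine Finset.sum_congr rfl fun i _ => ?_
  rw [Real.rpow_two, sq]

lemma schattenNorm_two_sq_of_isHermitian {x : Matrix (Fin n) (Fin n) ℂ} (hx : x.IsHermitian) :
    schattenNorm 2 x ^ 2 = (x * x).trace.re := by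
  rw [schattenNorm_two_sq, hsInner, hx.eq]

lemma isHermitian_sub_smul_one {x : Matrix (Fin n) (Fin n) ℂ} (hx : x.IsHermitian) (c : ℝ) :
    (x - (c : ℂ) • 1).IsHermitian := by
  rw [IsHermitian, conjTranspose_sub, hx.eq, conjTranspose_smul, conjTranspose_one,
    Complex.star_def, Complex.conj_ofReal]

lemma trace_sub_mean (hn : n ≠ 0) (x : Matrix (Fin n) (Fin n) ℂ) :
    (x - ((x.trace.re / n : ℝ) : ℂ) • 1).trace.re = 0 := by
  have : (n : ℝ) ≠ 0 := by exact_mod_cast hn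
  rw [trace_sub, trace_smul, trace_one, Fintype.card_fin, Complex.sub_re, smul_eq_mul,
    Complex.re_ofReal_mul, Complex.natCast_re]
  field_simp
  simp

/-- The trace form splits along the decomposition of a matrix into its scalar and traceless
parts. -/
lemma trace_mul_re_eq_add (hn : n ≠ 0) (x y : Matrix (Fin n) (Fin n) ℂ) :
    (x * y).trace.re = x.trace.re * y.trace.re / n +
      ((x - ((x.trace.re / n : ℝ) : ℂ) • 1) * (y - ((y.trace.re / n : ℝ) : ℂ) • 1)).trace.re := by
  have hn' : (n : ℝ) ≠ 0 := by exact_mod_cast hn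
  simp only [Matrix.sub_mul, Matrix.mul_sub, Matrix.smul_mul, Matrix.mul_smul, Matrix.one_mul,
    Matrix.mul_one, trace_sub, trace_smul, trace_one, Fintype.card_fin, Complex.sub_re,
    smul_eq_mul, Complex.re_ofReal_mul, Complex.natCast_re]
  field_simp
  ring

lemma schattenNorm_two_sq_eq_add (hn : n ≠ 0) {x : Matrix (Fin n) (Fin n) ℂ}
    (hx : x.IsHermitian) :
    schattenNorm 2 x ^ 2 = x.trace.re ^ 2 / n +
      schattenNorm 2 (x - ((x.trace.re / n : ℝ) : ℂ) • 1) ^ 2 := by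
  rw [schattenNorm_two_sq_of_isHermitian hx, trace_mul_re_eq_add hn,
    schattenNorm_two_sq_of_isHermitian (isHermitian_sub_smul_one hx _), sq]

/-- The defining inequality reads `‖x‖_2 √(n-1) ≤ τ(x)`. It is squared, at the cost of recording
`τ(x) ≥ 0`, and Pythagoras for the scalar and traceless parts leaves the factor `1/(n-1) - 1/n =
1/(n(n-1))`. -/
lemma mem_hsCone_iff (hn : 1 < n) {x : Matrix (Fin n) (Fin n) ℂ} :
    x ∈ hsCone n ↔ x.IsHermitian ∧ 0 ≤ x.trace.re ∧
      schattenNorm 2 (x - ((x.trace.re / n : ℝ) : ℂ) • 1) ^ 2 ≤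
        x.trace.re ^ 2 / (n * (n - 1)) := by
  refine and_congr_right fun hx => ?_
  have hn1 : (1 : ℝ) < n := by exact_mod_cast hn
  have hn0 : (0 : ℝ) < n := by linarith
  have hn2 : (0 : ℝ) < n - 1 := by linarith
  have hrhs : √((n : ℝ) / ((n : ℝ) - 1)) * (hsInner x (hsUnit n)).re =
      x.trace.re / √((n : ℝ) - 1) := by
    rw [hsInner, hsUnit, conjTranspose_smul, conjTranspose_one, Complex.star_def,
      Complex.conj_ofReal, Matrix.mul_smul, Matrix.mul_one, trace_smul, smul_eq_mul,
      Complex.re_ofReal_mul, Real.sqrt_div hn0.le]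
    have : √(n : ℝ) ≠ 0 := (Real.sqrt_pos.2 hn0).ne'
    field_simp
  have hs : 0 < √((n : ℝ) - 1) := Real.sqrt_pos.2 hn2
  have hN := schattenNorm_nonneg (p := 2) one_le_two x
  rw [hrhs, ← schattenNorm_two_sq, Real.sqrt_sq hN, le_div_iff₀ hs]
  have hsplit := schattenNorm_two_sq_eq_add (by omega) hx
  have hiff : schattenNorm 2 x ^ 2 * (n - 1) ≤ x.trace.re ^ 2 ↔
      schattenNorm 2 (x - ((x.trace.re / n : ℝ) : ℂ) • 1) ^ 2 ≤
        x.trace.re ^ 2 / (n * (n - 1)) := by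
    rw [← le_div_iff₀ hn2, hsplit, ← le_sub_iff_add_le']
    have : x.trace.re ^ 2 / ((n : ℝ) - 1) - x.trace.re ^ 2 / n =
        x.trace.re ^ 2 / (n * (n - 1)) := by field_simp; ring
    rw [this]
  have hsq : schattenNorm 2 x ^ 2 * (n - 1) = (schattenNorm 2 x * √((n : ℝ) - 1)) ^ 2 := by
    rw [mul_pow, Real.sq_sqrt hn2.le]
  rw [← hiff, hsq]
  constructor
  · intro h
    have h0 : 0 ≤ schattenNorm 2 x * √((n : ℝ) - 1) := by positivity
    exact ⟨h0.trans h, pow_le_pow_left₀ h0 h 2⟩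
  · rintro ⟨h0, h⟩
    exact le_of_sq_le_sq h h0

/-- Unit states are `y = e/n + y₀` with `y₀` hermitian and traceless and `‖y₀‖_2² ≤ 1 - 1/n`, and
`τ(xy) = τ(x)/n + τ(x₀y₀)`. By Cauchy–Schwarz, nonnegativity for all of them means `‖x₀‖_2 √(1 -
1/n) ≤ τ(x)/n`. -/
lemma schattenCone_two (hn : 1 < n) : schattenCone n 2 = hsCone n := by
  have hn1 : (1 : ℝ) < n := by exact_mod_cast hn
  have hn0 : (0 : ℝ) < n := by linarith
  have hn2 : (0 : ℝ) < n - 1 := by linarith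
  have hnz : n ≠ 0 := by omega
  ext x
  rw [mem_schattenCone_iff (p := 2) (q := 2) inferInstance, mem_hsCone_iff hn]
  refine and_congr_right fun hx => ?_
  set x₀ := x - ((x.trace.re / n : ℝ) : ℂ) • 1 with hx₀
  have hx₀h : x₀.IsHermitian := isHermitian_sub_smul_one hx _
  have hN := schattenNorm_nonneg (p := 2) one_le_two x₀
  constructor
  · intro h
    have hx₀tr : x₀.trace = 0 := Complex.ext (trace_sub_mean hnz x) (by
      simpa using trace_mul_im_eq_zero hx₀h isHermitian_one)
    -- The test states are `e/n - c x₀`, pointing against `x₀`; the bound on `c` keeps them in the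
    -- unit ball. The value `c = 0` gives `τ(x) ≥ 0`.
    have key : ∀ c : ℝ, c ^ 2 * schattenNorm 2 x₀ ^ 2 ≤ 1 - 1 / n →
        c * schattenNorm 2 x₀ ^ 2 ≤ x.trace.re / n := by
      intro c hc
      set y : Matrix (Fin n) (Fin n) ℂ := ((1 / n : ℝ) : ℂ) • 1 - (c : ℂ) • x₀ with hy
      have hyh : y.IsHermitian := by
        rw [IsHermitian, hy, conjTranspose_sub, conjTranspose_smul, conjTranspose_smul,
          conjTranspose_one, hx₀h.eq, Complex.star_def, Complex.conj_ofReal, Complex.conj_ofReal]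
      have hytr : y.trace = 1 := by
        have : (n : ℂ) ≠ 0 := by exact_mod_cast hnz
        rw [hy, trace_sub, trace_smul, trace_smul, hx₀tr, trace_one]
        simp [this]
      have hy₀ : y - ((y.trace.re / n : ℝ) : ℂ) • 1 = ((-c : ℝ) : ℂ) • x₀ := by
        rw [hytr, Complex.one_re, hy]
        simp
      have hynorm := schattenNorm_two_sq_eq_add hnz hyh
      rw [hy₀, (isStarNorm_schattenNorm one_le_two).smul, mul_pow, Complex.norm_real,
        Real.norm_eq_abs, sq_abs, hytr, Complex.one_re, neg_sq, one_pow] at hynorm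
      have hymem : y ∈ unitBallStates n 2 := by
        refine ⟨hyh, hytr, le_of_sq_le_sq ?_ zero_le_one⟩
        rw [hynorm]
        linarith
      have h1 := h y hymem
      rw [trace_mul_re_eq_add hnz, hy₀, ← hx₀, Matrix.mul_smul, trace_smul, smul_eq_mul,
        Complex.re_ofReal_mul, ← schattenNorm_two_sq_of_isHermitian hx₀h, hytr, Complex.one_re,
        mul_one] at h1
      linarith
    have hfrac : (0 : ℝ) < 1 - 1 / n := by
      rw [sub_pos, div_lt_one hn0]; exact hn1
    have ht : 0 ≤ x.trace.re / n := by
      have := key 0 (by simpa using hfrac.le)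
      simpa using this
    refine ⟨by simpa [hn0.ne'] using mul_nonneg ht hn0.le, ?_⟩
    rcases hN.eq_or_lt with h0 | hpos
    · rw [← h0, zero_pow two_ne_zero]
      positivity
    -- The largest admissible `c` puts the test state on the unit sphere, giving the sharp
    -- inequality.
    · have h1 := key (√(1 - 1 / n) / schattenNorm 2 x₀) (by
        rw [div_pow, Real.sq_sqrt hfrac.le]
        field_simp
        exact le_rfl)
      have h2 : √(1 - 1 / (n : ℝ)) * schattenNorm 2 x₀ ≤ x.trace.re / n := by
        refine le_of_eq_of_le ?_ h1
        field_simp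
      have h3 := pow_le_pow_left₀ (by positivity) h2 2
      rw [mul_pow, Real.sq_sqrt hfrac.le, div_pow] at h3
      rw [le_div_iff₀ (by positivity)]
      have h4 := mul_le_mul_of_nonneg_right h3 (sq_nonneg (n : ℝ))
      rw [div_mul_cancel₀ _ (by positivity)] at h4
      refine le_of_eq_of_le ?_ h4
      field_simp
  · rintro ⟨ht, hle⟩ y hy
    set y₀ := y - ((y.trace.re / n : ℝ) : ℂ) • 1 with hy₀
    have hytr : y.trace.re = 1 := by rw [hy.2.1, Complex.one_re]
    have hy1 := schattenNorm_two_sq_eq_add hnz hy.1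
    have hN' := schattenNorm_nonneg (p := 2) one_le_two y₀
    have hy2 : schattenNorm 2 y ^ 2 ≤ 1 :=
      pow_le_one₀ (schattenNorm_nonneg one_le_two y) hy.2.2
    rw [← hy₀, hytr] at hy1
    have hprod : schattenNorm 2 x₀ * schattenNorm 2 y₀ ≤ x.trace.re / n := by
      refine le_of_sq_le_sq ?_ (by positivity)
      rw [mul_pow]
      calc schattenNorm 2 x₀ ^ 2 * schattenNorm 2 y₀ ^ 2
          ≤ x.trace.re ^ 2 / (n * (n - 1)) * (1 - 1 / n) :=
            mul_le_mul hle (by rw [one_pow] at hy1; linarith) (by positivity) (by positivity)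
        _ = (x.trace.re / n) ^ 2 := by field_simp
    have h1 := (abs_le.1 ((Complex.abs_re_le_norm _).trans (norm_trace_mul_le (p := 2) (q := 2)
      inferInstance x₀ y₀))).1
    rw [trace_mul_re_eq_add hnz, hytr, mul_one, ← hx₀]
    rw [← hytr, ← hy₀]
    linarith

end HilbertSchmidt

end ProjPos

end

theorem mainTheorem4 (n : ℕ) (hn : 1 < n) :
    -- every Schatten space is a unital `*`-normed space with unit the identity
    (∀ p : ℝ≥0∞, 1 ≤ p →
      IsUnitalStarNormed (schattenNorm (n := n) p) 1) ∧
    -- it is a function system for the projective cone given by `ε = 1`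
    (∀ p : ℝ≥0∞, 1 ≤ p → p ≠ ∞ → 1 / schattenNorm p (1 : Matrix (Fin n) (Fin n) ℂ) < 1) ∧
    (∀ p : ℝ≥0∞, 1 ≤ p →
      IsProjectiveFunctionSystem (schattenNorm (n := n) p) 1 1) ∧
    -- the cones form an increasing family of unital cones
    (∀ ε : ℝ, (n : ℝ) ≤ ε →
      IsUnitalCone (schattenNorm (n := n) ∞) 1 (deformedCone n ε) ∧
      deformedCone n ε ⊆ schattenCone n 1) ∧
    (∀ p₁ p₂ : ℝ≥0∞, 1 ≤ p₁ → p₁ ≤ p₂ → schattenCone n p₁ ⊆ schattenCone n p₂) ∧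
    schattenCone n ∞ = posCone n ∧
    -- the state spaces
    coneStates 1 (posCone n) = traceFunctional '' densityMatrices n ∧
    (∀ p q : ℝ≥0∞, p.HolderConjugate q →
      coneStates 1 (schattenCone n p) = traceFunctional '' orthogonalDifferences n q ∧
      coneStates 1 (schattenCone n p) = traceFunctional '' orthogonalDifferencesNonneg n q) ∧
    -- the Hilbert--Schmidt case
    schattenCone n 2 = hsCone n := by
  have hn0 : 0 < n := by omega
  refine ⟨fun p hp => isUnitalStarNormed_schattenNorm hn0 hp,
    fun p hp hp' => one_div_schattenNorm_one_lt hn hp hp',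
    fun p hp => isProjectiveFunctionSystem_schattenNorm hn0 hp,
    fun ε hε => ?_, fun p₁ p₂ h₁ h => schattenCone_mono h₁ h, schattenCone_top,
    coneStates_posCone hn0, fun p q hpq => ?_, schattenCone_two hn⟩
  · have hε1 : 1 ≤ ε := le_trans (by exact_mod_cast hn.le) hε
    exact ⟨isUnitalCone_deformedCone hε1, deformedCone_subset (zero_le_one.trans hε1) hε⟩
  · have := hpq.symm
    have hq := ENNReal.HolderConjugate.one_le q p
    rw [orthogonalDifferences_eq hn hq, orthogonalDifferencesNonneg_eq hq]
    exact ⟨coneStates_schattenCone hn0 hpq, coneStates_schattenCone hn0 hpq⟩
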